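/- Let $(\mathcal X,d)$ be a finite non-empty metric space, let $\lambda_x>0$ for $x\in\mathcal X$, and let $f(t)=t^\alpha$ with $\alpha\ge 0$ (with $0^0=1$, so $f\equiv 1$ if $\alpha=0$). A *request* $r$ has a location $\ell(r)\in\mathcal X$ and an arrival time $t(r)\ge 0$. A *solution* for a sequence $\sigma$ of $m$ requests, $m$ even, is a perfect matching $M$ of the requests together with service times $s(r)\ge t(r)$ that are equal for matched requests; its cost in the *$t^\alpha$-MPMD problem* is $\sum_{r}f(s(r)-t(r))+\sum_{(r,r')\in M}d(\ell(r),\ell(r'))$. Let $\mathrm{OPT}(\sigma)$ be the minimum cost of a solution. *Poisson arrival model.* The waiting times between consecutive requests at $x$ (the first one counted from time $0$) are exponential with parameter $\lambda_x$, and all waiting times at all points are mutually independent. A random sequence of length $m$ consists of the first $m$ requests arriving in $\mathcal X$; $\mathbb E^m_\sigma$ denotes expectation over it. An algorithm has *ratio of expectations* $K\ge 1$ if $$\limsup_{m\to\infty,\ m\text{ even}}\ \frac{\mathbb E^m_\sigma[\mathrm{ALG}(\sigma)]}{\mathbb E^m_\sigma[\mathrm{OPT}(\sigma)]}\le K .$$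 *Greedy*: at any time $t$ at which there are two pending (arrived and still unmatched) requests $r,r'$ with $f(t-t(r))+f(t-t(r'))\ge d(\ell(r),\ell(r'))$, match such a pair, ties broken arbitrarily. *Radius*: let $\rho_x$ be the smallest $u\in[0,\infty]$ with $u\ge\mathbb E[f(W)]$, where $W$ is exponential with parameter $\sum_{y:\,d(x,y)\le u}\lambda_y$. Process the requests in order of arrival. When $r$ arrives: if there is a pending $r'$ with $d(\ell(r),\ell(r'))\le\rho_{\ell(r')}$, match $r$ with such an $r'$; otherwise, if there is a pending $r'$ with $d(\ell(r),\ell(r'))\le\rho_{\ell(r)}+\rho_{\ell(r')}$, match $r$ with such an $r'$; otherwise $r$ becomes pending (ties broken arbitrarily). When the last request has been processed, match all remaining pending requests arbitrarily at that moment. **Corollary ($t^\alpha$-MPMD).** There is an absolute constant $C>0$ (independent of $\alpha$, of the metric space and of the rates) such that for every finite non-empty metric space and all rates $\lambda_x>0$, in the Poisson arrival model: for every $\alpha>0$ the Greedy algorithm, and for every $\alpha\ge 0$ the Radius algorithm, however ties are broken, achieves a ratio of expectations of $e^{C(1+\alpha)}$ for the $t^\alpha$-MPMD problem. -/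

import Mathlib

open MeasureTheory ProbabilityTheory Filter
open scoped ENNReal

noncomputable section

namespace MPMD

/-- A request: a location in the metric space and an arrival time. -/
structure Request (X : Type*) where
  loc : X
  time : ℝ

section Solutions

variable {X : Type*} [MetricSpace X] {m : ℕ}

/-- A feasible (offline) solution for a sequence of `m` requests: a perfect matching, given by the
fixed-point free involution `partner`, and the moment `serve i` at which request `i` is matched. -/
structure Solution (σ : Fin m → Request X) where
  partner : Fin m → Fin m
  partner_partner : ∀ i, partner (partner i) = i
  partner_ne : ∀ i, partner i ≠ i
  serve : Fin m → ℝ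
  serve_partner : ∀ i, serve (partner i) = serve i
  time_le_serve : ∀ i, (σ i).time ≤ serve i

/-- Delay cost plus connection cost, for the delay cost function `f`. Every matched pair is counted
once in the connection cost, through its request of smaller index. -/
def Solution.cost {σ : Fin m → Request X} (A : Solution σ) (f : ℝ → ℝ) : ℝ :=
  ∑ i, f (A.serve i - (σ i).time)
    + ∑ i with i < A.partner i, dist (σ i).loc (σ (A.partner i)).loc

/-- Cost of an optimal offline solution for the delay cost function `f`. -/
def opt (f : ℝ → ℝ) (σ : Fin m → Request X) : ℝ≥0∞ :=
  ⨅ A : Solution σ, ENNReal.ofReal (A.cost f)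

open Classical in
/-- Cost of an algorithm with arbitrary tie-breaking whose possible outputs on `σ` are the solutions
satisfying `Output`: the largest cost over all ways of breaking the ties. It is `∞` if the
algorithm has no output, i.e. if it fails to produce a perfect matching. -/
def worstCost (f : ℝ → ℝ) (σ : Fin m → Request X) (Output : Solution σ → Prop) : ℝ≥0∞ :=
  if ∃ A, Output A then ⨆ (A : Solution σ) (_ : Output A), ENNReal.ofReal (A.cost f) else ⊤

/-- The Greedy algorithm for the delay cost function `f`: two requests are matched at a moment at
which the sum of their delay costs is at least their distance, and at no moment `t` does Greedy
leave two such requests `i`, `j` both pending (that is, arrived by time `t` and matched only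
after time `t`). -/
structure IsGreedy (f : ℝ → ℝ) {σ : Fin m → Request X} (A : Solution σ) : Prop where
  matched : ∀ i, dist (σ i).loc (σ (A.partner i)).loc ≤
    f (A.serve i - (σ i).time) + f (A.serve i - (σ (A.partner i)).time)
  pending : ∀ i j, i ≠ j → ∀ t, (σ i).time ≤ t → (σ j).time ≤ t → t < A.serve i → t < A.serve j →
    f (t - (σ i).time) + f (t - (σ j).time) < dist (σ i).loc (σ j).loc

/-- With `L` the set of requests that are left over after the last arrival: request `j` is pending
when request `i` is processed, i.e. `j` came before `i` and was not matched with a request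
preceding `i`. -/
def RadiusPending {σ : Fin m → Request X} (A : Solution σ) (L : Set (Fin m)) (i j : Fin m) : Prop :=
  j < i ∧ (j ∈ L ∨ i ≤ A.partner j)

/-- The Radius algorithm with radii `ρ`. The requests are processed in the order of their indices.
If some pending request `j` has the location of `i` in its closed ball, then `i` is matched
at once with such a `j`; otherwise, if the ball of `i` and that of some pending request `j` are
close enough to overlap, `i` is matched at once with such a `j`; otherwise `i` becomes pending.
The requests in `L`, those still pending in the end, are matched arbitrarily with each other at the
arrival time of the last request. -/
def IsRadius (ρ : X → ℝ≥0∞) {σ : Fin m → Request X} (A : Solution σ) : Prop :=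
  ∃ L : Set (Fin m),
    (∀ i, i ∈ L ↔ A.partner i ∈ L) ∧
    (∀ i ∈ L, IsGreatest (Set.range fun j => (σ j).time) (A.serve i)) ∧
    (∀ i, i ∉ L → A.serve i = max (σ i).time (σ (A.partner i)).time) ∧
    ∀ i,
      let near : Fin m → Prop := fun j =>
        RadiusPending A L i j ∧ edist (σ i).loc (σ j).loc ≤ ρ (σ j).loc
      let overlap : Fin m → Prop := fun j =>
        RadiusPending A L i j ∧ edist (σ i).loc (σ j).loc ≤ ρ (σ j).loc + ρ (σ i).loc
      ((∃ j, near j) → i ∉ L ∧ near (A.partner i)) ∧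
      ((¬ ∃ j, near j) → (∃ j, overlap j) → i ∉ L ∧ overlap (A.partner i)) ∧
      ((¬ ∃ j, near j) → (¬ ∃ j, overlap j) → i ∈ L ∨ i < A.partner i)

end Solutions

section Model

variable {X : Type*} [Fintype X] [MetricSpace X]

open Classical in
/-- `λ` of the closed ball around `x` with radius `u`, where `u` may be infinite. -/
def ballRate (lam : X → ℝ) (x : X) (u : ℝ≥0∞) : ℝ := ∑ y with edist x y ≤ u, lam y

/-- The radius of `x`: the smallest `u ∈ [0, ∞]` with `𝔼[f(W)] ≤ u`, where `W` is an exponential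
variable whose parameter is the total rate of the closed ball around `x` with radius `u`. -/
def radius (f : ℝ → ℝ) (lam : X → ℝ) (x : X) : ℝ≥0∞ :=
  sInf {u : ℝ≥0∞ | ∫⁻ t, ENNReal.ofReal (f t) ∂(expMeasure (ballRate lam x u)) ≤ u}

/-- The joint law of the waiting times: `ω (x, i)` is the waiting time for the `i`-th request at `x`
(counted from `0`) since the preceding request at `x`, or since time `0` if there is none. They are
mutually independent and exponential with parameter `lam x`. -/
def waitingLaw (lam : X → ℝ) : Measure (X × ℕ → ℝ) :=
  Measure.infinitePi fun p => expMeasure (lam p.1)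

/-- Arrival time of the `i`-th request (counted from `0`) at `x`. -/
def arrival (ω : X × ℕ → ℝ) (x : X) (i : ℕ) : ℝ := ∑ j ∈ Finset.range (i + 1), ω (x, j)

variable [Nonempty X]

/-- If `c x` requests have already arrived at `x`, for every `x`, this is the location of the next
request of the whole sequence: a point whose next arrival is the earliest one. -/
def nextLoc (ω : X × ℕ → ℝ) (c : X → ℕ) : X :=
  Classical.choose (Finite.exists_min fun x => arrival ω x (c x))

open Classical in
/-- The number of requests at each point among the first `k` requests of the whole sequence. -/
def counts (ω : X × ℕ → ℝ) : ℕ → X → ℕ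
  | 0 => fun _ => 0
  | k + 1 => Function.update (counts ω k) (nextLoc ω (counts ω k))
      (counts ω k (nextLoc ω (counts ω k)) + 1)

/-- The random request sequence of length `m`: the first `m` requests arriving at the points of the
metric space, in the order of their arrival. -/
def requests (ω : X × ℕ → ℝ) (m : ℕ) : Fin m → Request X := fun k =>
  let x := nextLoc ω (counts ω k)
  ⟨x, arrival ω x (counts ω k x)⟩

/-- Expected cost over all random request sequences of length `m`. -/
def expected (lam : X → ℝ) (m : ℕ) (cost : (Fin m → Request X) → ℝ≥0∞) : ℝ≥0∞ :=
  ∫⁻ ω, cost (requests ω m) ∂(waitingLaw lam)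

/-- An algorithm for `f`-MPMD with cost `alg` on every request sequence has ratio of expectations
`C`, for the arrival rates `lam`. The number `m = 2 * k` of requests is even. -/
def HasRatioOfExpectations (f : ℝ → ℝ) (lam : X → ℝ)
    (alg : (m : ℕ) → (Fin m → Request X) → ℝ≥0∞) (C : ℝ) : Prop :=
  1 ≤ C ∧
  limsup (fun k : ℕ => expected lam (2 * k) (alg (2 * k)) / expected lam (2 * k) (opt f)) atTop
    ≤ ENNReal.ofReal C

/-- Cost of Greedy for the delay cost function `f`. -/
def greedyCost (f : ℝ → ℝ) (m : ℕ) (σ : Fin m → Request X) : ℝ≥0∞ :=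
  worstCost f σ (IsGreedy f)

/-- Cost of Radius for the delay cost function `f`. -/
def radiusCost (f : ℝ → ℝ) (lam : X → ℝ) (m : ℕ) (σ : Fin m → Request X) : ℝ≥0∞ :=
  worstCost f σ (IsRadius (radius f lam))

end Model

end MPMD

end

noncomputable section

namespace MPMD

-- Exponential distributions and a bound on Γ

lemma lintegral_expMeasure (r : ℝ) (g : ℝ → ℝ≥0∞) (hg : Measurable g) :
    ∫⁻ t, g t ∂(expMeasure r) = ∫⁻ t in Set.Ioi 0, ENNReal.ofReal (r * Real.exp (-(r * t))) * g t := by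
  rw [expMeasure, gammaMeasure, show gammaPDF 1 r = fun x => ENNReal.ofReal (gammaPDFReal 1 r x) from rfl,
    lintegral_withDensity_eq_lintegral_mul _
      (measurable_gammaPDFReal 1 r).ennreal_ofReal hg,
    ← setLIntegral_univ, ← Set.Iic_union_Ioi (a := (0 : ℝ)),
    lintegral_union measurableSet_Ioi (Set.Iic_disjoint_Ioi le_rfl),
    ← setLIntegral_congr (Iio_ae_eq_Iic (a := (0:ℝ)))]
  have h1 : ∫⁻ a in Set.Iio (0:ℝ), ((fun x => ENNReal.ofReal (gammaPDFReal 1 r x)) * g) a = 0 := by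
    rw [setLIntegral_congr_fun (g := fun _ => 0) measurableSet_Iio]
    · simp
    · intro x hx
      have := gammaPDF_of_neg (a := 1) (r := r) hx
      rw [gammaPDF] at this
      simp [this]
  rw [h1, zero_add]
  refine setLIntegral_congr_fun measurableSet_Ioi fun x hx => ?_
  have := exponentialPDF_of_nonneg (r := r) (le_of_lt hx)
  rw [← this]
  rfl

lemma expMeasure_Ioi {r : ℝ} (hr : 0 < r) {t : ℝ} (ht : 0 ≤ t) :
    expMeasure r (Set.Ioi t) = ENNReal.ofReal (Real.exp (-(r * t))) := by
  have := isProbabilityMeasure_expMeasure hr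
  rw [← Set.compl_Iic, prob_compl_eq_one_sub measurableSet_Iic]
  have h := cdf_expMeasure_eq hr t
  rw [cdf_eq_real, if_pos ht] at h
  rw [← ofReal_measureReal, h, ← ENNReal.ofReal_one,
    ← ENNReal.ofReal_sub _ (by simpa using mul_nonneg hr.le ht)]
  congr 1
  ring

lemma ae_expMeasure_pos {r : ℝ} (hr : 0 < r) : ∀ᵐ t ∂(expMeasure r), 0 < t := by
  have := isProbabilityMeasure_expMeasure hr
  refine (mem_ae_iff_prob_eq_one measurableSet_Ioi).2 ?_
  simp [expMeasure_Ioi hr le_rfl]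

lemma expMeasure_memoryless {r t : ℝ} (ht : 0 ≤ t) {A : Set ℝ}
    (hA : MeasurableSet A) :
    expMeasure r {w | t < w ∧ w - t ∈ A} = ENNReal.ofReal (Real.exp (-(r * t))) * expMeasure r A := by
  have hB : MeasurableSet {w : ℝ | t < w ∧ w - t ∈ A} :=
    (measurableSet_lt measurable_const measurable_id).inter
      (measurable_id.sub_const t hA)
  rw [← lintegral_indicator_one hB, ← lintegral_indicator_one hA,
    lintegral_expMeasure _ _ (measurable_one.indicator hB),
    lintegral_expMeasure _ _ (measurable_one.indicator hA),
    ← lintegral_const_mul _ (by measurability), ← lintegral_indicator measurableSet_Ioi,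
    ← lintegral_indicator measurableSet_Ioi]
  conv_rhs => rw [← lintegral_sub_right_eq_self _ t]
  refine lintegral_congr fun w => ?_
  simp only [Set.indicator, Set.mem_Ioi, sub_pos, Pi.one_apply]
  by_cases h : t < w
  · by_cases h' : w - t ∈ A
    · rw [if_pos (ht.trans_lt h), if_pos (show w ∈ {w | t < w ∧ w - t ∈ A} from ⟨h, h'⟩),
        if_pos h, if_pos h', mul_one, mul_one, ← ENNReal.ofReal_mul (Real.exp_nonneg _)]
      congr 1
      rw [mul_left_comm, ← Real.exp_add]
      congr 2
      ring
    · rw [if_neg h', if_neg (show w ∉ {w | t < w ∧ w - t ∈ A} from fun H => h' H.2)]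
      simp
  · rw [if_neg h, if_neg (show w ∉ {w | t < w ∧ w - t ∈ A} from fun H => h H.1)]
    simp

/-- The exponential weight changes the rate from r to s. In the race between the points it is the
probability that all other points are still waiting, with s the total rate, and r / s becomes the
probability of winning. -/
lemma lintegral_expMeasure_tilt {r s : ℝ} (hr : 0 < r) (hs : 0 < s) (g : ℝ → ℝ≥0∞)
    (hg : Measurable g) :
    ∫⁻ t, ENNReal.ofReal (Real.exp (-((s - r) * t))) * g t ∂(expMeasure r) =
      ENNReal.ofReal (r / s) * ∫⁻ t, g t ∂(expMeasure s) := by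
  rw [lintegral_expMeasure _ _ (by fun_prop), lintegral_expMeasure _ _ hg,
    ← lintegral_const_mul _ (by fun_prop)]
  refine lintegral_congr fun t => ?_
  rw [← mul_assoc, ← mul_assoc, ← ENNReal.ofReal_mul (by positivity),
    ← ENNReal.ofReal_mul (by positivity)]
  congr 2
  rw [mul_assoc, ← Real.exp_add, ← mul_assoc, div_mul_cancel₀ _ hs.ne']
  congr 2
  ring

lemma lintegral_rpow_expMeasure {r α : ℝ} (hr : 0 < r) (hα : 0 ≤ α) :
    ∫⁻ t, ENNReal.ofReal (t ^ α) ∂(expMeasure r) =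
      ENNReal.ofReal (Real.Gamma (α + 1) / r ^ α) := by
  rw [lintegral_expMeasure _ _ (by fun_prop)]
  have h1 := Real.integral_rpow_mul_exp_neg_mul_Ioi (a := α + 1) (r := r) (by linarith) hr
  have h2 : IntegrableOn (fun t : ℝ => t ^ α * Real.exp (-(r * t))) (Set.Ioi 0) := by
    have := integrableOn_rpow_mul_exp_neg_mul_rpow (p := 1) (s := α) (b := r) (by linarith) one_pos hr
    simpa using this
  have h3 : ∫ t : ℝ in Set.Ioi 0, r * (t ^ α * Real.exp (-(r * t))) =
      Real.Gamma (α + 1) / r ^ α := by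
    rw [integral_const_mul]
    simp only [add_sub_cancel_right] at h1
    rw [h1, Real.rpow_add (by positivity), Real.div_rpow zero_le_one hr.le]
    have := Real.rpow_pos_of_pos hr α
    simp
    field_simp
  rw [← h3, ofReal_integral_eq_lintegral_ofReal (h2.const_mul r)]
  · refine setLIntegral_congr_fun measurableSet_Ioi fun t ht => ?_
    have ht' : 0 < t := ht
    change _ = ENNReal.ofReal (r * (t ^ α * Real.exp (-(r * t))))
    rw [← ENNReal.ofReal_mul (by positivity)]
    congr 1
    ring
  · refine (ae_restrict_mem measurableSet_Ioi).mono fun t ht => ?_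
    have ht' : (0:ℝ) < t := ht
    change 0 ≤ r * (t ^ α * Real.exp (-(r * t)))
    positivity

/-- Log-convexity gives Γ(n + x) ≤ Γ(n) n^x for 0 < x ≤ 1, and Γ(n) = (n-1)! ≤ n^{n-1}. This keeps
the final ratio exponential in α rather than factorial. -/
lemma Gamma_add_one_le_rpow {α : ℝ} (hα : 0 ≤ α) : Real.Gamma (α + 1) ≤ (α + 1) ^ α := by
  rcases hα.eq_or_lt with rfl | hα
  · simp
  -- Split α + 1 = n + x with n = ⌈α⌉, so that the fractional step x lies in (0, 1].
  obtain ⟨n, x, hx0, hx1, hn, rfl⟩ : ∃ (n : ℕ) (x : ℝ), 0 < x ∧ x ≤ 1 ∧ n ≠ 0 ∧ α = n + x - 1 := by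
    refine ⟨⌈α⌉₊, α + 1 - ⌈α⌉₊, ?_, ?_, ?_, by ring⟩
    · have := Nat.ceil_lt_add_one hα.le
      linarith
    · have := Nat.le_ceil α
      linarith
    · have := Nat.ceil_pos.2 hα
      omega
  have h := Real.BohrMollerup.f_add_nat_le (f := Real.log ∘ Real.Gamma) (n := n) (x := x)
    Real.convexOn_log_Gamma (fun {y} hy => by
      simp only [Function.comp]
      rw [Real.Gamma_add_one hy.ne', Real.log_mul hy.ne' (Real.Gamma_pos_of_pos hy).ne', add_comm])
    hn hx0 hx1
  have hn1 : (1:ℝ) ≤ n := by exact_mod_cast Nat.one_le_iff_ne_zero.2 hn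
  have hf : Real.Gamma n ≤ (n:ℝ) ^ ((n:ℝ) - 1) := by
    obtain ⟨k, rfl⟩ := Nat.exists_eq_succ_of_ne_zero hn
    push_cast
    rw [Real.Gamma_nat_eq_factorial, add_sub_cancel_right, Real.rpow_natCast]
    exact_mod_cast (Nat.factorial_le_pow k).trans (Nat.pow_le_pow_left (Nat.le_succ k) k)
  have hG : 0 < Real.Gamma n := Real.Gamma_pos_of_pos (by linarith)
  simp only [Function.comp] at h
  have h4 : Real.Gamma (n + x) ≤ Real.Gamma n * (n:ℝ) ^ x := by
    rw [← Real.log_le_log_iff (Real.Gamma_pos_of_pos (by linarith)) (by positivity),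
      Real.log_mul hG.ne' (by positivity), Real.log_rpow (by linarith)]
    exact h
  rw [sub_add_cancel]
  calc Real.Gamma (n + x) ≤ Real.Gamma n * (n:ℝ) ^ x := h4
    _ ≤ (n:ℝ) ^ ((n:ℝ) - 1) * (n:ℝ) ^ x := by gcongr
    _ = (n:ℝ) ^ ((n:ℝ) + x - 1) := by rw [← Real.rpow_add (by linarith)]; congr 1; ring
    _ ≤ _ := Real.rpow_le_rpow (by linarith) (by linarith) (by linarith)

lemma add_rpow_le_two_rpow_mul {α a b : ℝ} (hα : 0 ≤ α) (ha : 0 ≤ a) (hb : 0 ≤ b) :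
    (a + b) ^ α ≤ 2 ^ α * (a ^ α + b ^ α) := by
  have h : (a + b) ^ α ≤ (2 * max a b) ^ α :=
    Real.rpow_le_rpow (by positivity) (by linarith [le_max_left a b, le_max_right a b]) hα
  rw [Real.mul_rpow (by norm_num) (le_max_of_le_left ha)] at h
  refine h.trans ?_
  gcongr
  rcases max_choice a b with h | h <;> rw [h]
  · linarith [Real.rpow_nonneg hb α]
  · linarith [Real.rpow_nonneg ha α]

instance (X : Type*) (lam : X → ℝ) [h : Fact (∀ x, 0 < lam x)] (x : X) :
    IsProbabilityMeasure (expMeasure (lam x)) := isProbabilityMeasure_expMeasure (h.out x)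

instance (X : Type*) (lam : X → ℝ) [Fact (∀ x, 0 < lam x)] :
    IsProbabilityMeasure (waitingLaw lam) :=
  inferInstanceAs (IsProbabilityMeasure (Measure.infinitePi fun p : X × ℕ => expMeasure (lam p.1)))

-- Invariance properties of the law of the waiting times

section Coordinates

variable {X : Type*}

open Classical in
/-- Remove the first waiting time at `x`. -/
def dropFirst (x : X) (ω : X × ℕ → ℝ) : X × ℕ → ℝ :=
  fun p => if p.1 = x then ω (p.1, p.2 + 1) else ω p

open Classical in
/-- Insert a new first waiting time at `x`. -/
def consFirst (x : X) (q : ℝ × (X × ℕ → ℝ)) : X × ℕ → ℝ :=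
  fun p => if p = (x, 0) then q.1 else if p.1 = x then q.2 (p.1, p.2 - 1) else q.2 p

open Classical in
/-- Reduce the first waiting times at the points of `B` by `t`. -/
def advance (B : Finset X) (t : ℝ) (ω : X × ℕ → ℝ) : X × ℕ → ℝ :=
  fun p => if p.1 ∈ B ∧ p.2 = 0 then ω p - t else ω p

lemma measurable_dropFirst (x : X) : Measurable (dropFirst x) := by
  refine measurable_pi_iff.2 fun p => ?_
  unfold dropFirst
  split_ifs <;> fun_prop

lemma measurable_consFirst (x : X) : Measurable (consFirst x) := by
  refine measurable_pi_iff.2 fun p => ?_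
  unfold consFirst
  split_ifs <;> fun_prop

lemma measurable_advance (B : Finset X) :
    Measurable fun q : ℝ × (X × ℕ → ℝ) => advance B q.1 q.2 := by
  refine measurable_pi_iff.2 fun p => ?_
  unfold advance
  split_ifs <;> fun_prop

lemma dropFirst_consFirst (x : X) (q : ℝ × (X × ℕ → ℝ)) : dropFirst x (consFirst x q) = q.2 := by
  funext p
  obtain ⟨y, j⟩ := p
  by_cases h : y = x <;> simp [dropFirst, consFirst, h]

lemma consFirst_apply_zero (x : X) (q : ℝ × (X × ℕ → ℝ)) : consFirst x q (x, 0) = q.1 := by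
  simp [consFirst]

variable (lam : X → ℝ) [hlam : Fact (∀ x, 0 < lam x)]

/-- Coordinates are only relabelled, and those at x share one law; it suffices to check this on
finite boxes. In the proof `e` maps an old index to its position in the shortened family, and `g`
inverts it. -/
lemma map_consFirst (x : X) :
    ((expMeasure (lam x)).prod (waitingLaw lam)).map (consFirst x) = waitingLaw lam := by
  classical
  refine Measure.eq_infinitePi _ fun s t ht => ?_
  let e : X × ℕ → X × ℕ := fun p => if p.1 = x then (p.1, p.2 - 1) else p
  have he : Set.InjOn e (s.erase (x, 0)) := by
    rintro ⟨y, j⟩ h ⟨z, k⟩ h' hjk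
    simp only [Finset.coe_erase, Set.mem_sdiff, Finset.mem_coe, Set.mem_singleton_iff,
      Prod.mk.injEq, not_and] at h h'
    simp only [e] at hjk
    split_ifs at hjk with h1 h2 h2
    · simp only [Prod.mk.injEq] at hjk
      have := h.2 h1
      have := h'.2 h2
      exact Prod.ext hjk.1 (by simp only; omega)
    · simp only [Prod.mk.injEq] at hjk
      exact absurd (hjk.1 ▸ h1) h2
    · simp only [Prod.mk.injEq] at hjk
      exact absurd (hjk.1 ▸ h2) h1
    · exact hjk
  let g : X × ℕ → X × ℕ := fun p => if p.1 = x then (p.1, p.2 + 1) else p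
  have hge : ∀ p ∈ s.erase (x, 0), g (e p) = p := by
    rintro ⟨y, j⟩ h
    simp only [Finset.mem_erase, ne_eq, Prod.mk.injEq, not_and] at h
    by_cases h1 : y = x
    · have := h.1 h1
      simp only [g, e, h1, if_true, Prod.mk.injEq, true_and]
      omega
    · simp [g, e, h1]
  have hpre : consFirst x ⁻¹' Set.pi s t =
      {a | (x, 0) ∈ s → a ∈ t (x, 0)} ×ˢ
        Set.pi (((s.erase (x, 0)).image e : Finset (X × ℕ)) : Set (X × ℕ)) (fun q => t (g q)) := by
    ext q
    simp only [Set.mem_preimage, Set.mem_pi, Finset.mem_coe, Set.mem_prod, Finset.mem_image,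
      forall_exists_index, and_imp, forall_apply_eq_imp_iff₂]
    constructor
    · intro h
      refine ⟨fun h0 => by simpa [consFirst] using h _ h0, fun p hp => ?_⟩
      rw [hge p hp]
      have := h p (Finset.mem_of_mem_erase hp)
      rw [consFirst, if_neg (Finset.ne_of_mem_erase hp)] at this
      simp only [e]
      split_ifs with h1
      · rwa [if_pos h1] at this
      · rwa [if_neg h1] at this
    · rintro ⟨h1, h2⟩ p hp
      by_cases h0 : p = (x, 0)
      · subst h0
        simpa [consFirst] using h1 hp
      · have h3 : p ∈ s.erase (x, 0) := Finset.mem_erase.2 ⟨h0, hp⟩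
        have := h2 p h3
        rw [hge p h3] at this
        rw [consFirst, if_neg h0]
        simp only [e] at this
        split_ifs with h1
        · rwa [if_pos h1] at this
        · rwa [if_neg h1] at this
  rw [Measure.map_apply (measurable_consFirst x)
    (.pi s.countable_toSet fun p _ => ht p), hpre, Measure.prod_prod, waitingLaw,
    Measure.infinitePi_pi _ (fun i _ => ht _), Finset.prod_image he]
  have h1 : ∏ p ∈ s.erase (x, 0), expMeasure (lam (e p).1) (t (g (e p))) =
      ∏ p ∈ s.erase (x, 0), expMeasure (lam p.1) (t p) := by
    refine Finset.prod_congr rfl fun p hp => ?_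
    rw [hge p hp]
    congr 3
    simp only [e]
    split_ifs <;> rfl
  rw [h1]
  by_cases h0 : (x, 0) ∈ s
  · rw [← Finset.mul_prod_erase s _ h0]
    simp [h0]
  · rw [Finset.erase_eq_of_notMem h0]
    simp [h0]

lemma map_dropFirst (x : X) :
    (waitingLaw lam).map (fun ω => (ω (x, 0), dropFirst x ω)) =
      (expMeasure (lam x)).prod (waitingLaw lam) := by
  conv_lhs => rw [← map_consFirst lam x]
  have hm := measurable_dropFirst x
  rw [Measure.map_map (by fun_prop) (measurable_consFirst x)]
  convert Measure.map_id
  funext q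
  exact Prod.ext (consFirst_apply_zero x q) (dropFirst_consFirst x q)

/-- Memorylessness of the whole family: on the event that nothing arrives in B up to time t, the
residual waiting times have the original law, weighted by the probability of the event. It holds
coordinate by coordinate on boxes. -/
lemma map_advance (B : Finset X) {t : ℝ} (ht : 0 ≤ t) :
    ((waitingLaw lam).restrict {ω | ∀ y ∈ B, t < ω (y, 0)}).map (advance B t) =
      ENNReal.ofReal (Real.exp (-((∑ y ∈ B, lam y) * t))) • waitingLaw lam := by
  classical
  set c := ENNReal.ofReal (Real.exp (-((∑ y ∈ B, lam y) * t))) with hc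
  have hc0 : c ≠ 0 := by simp [hc, Real.exp_pos]
  have hct : c ≠ ⊤ := ENNReal.ofReal_ne_top
  have hm : Measurable (advance B t) := (measurable_advance B).comp measurable_prodMk_left
  -- Normalise first, since the product measure is characterised by its exact values on boxes.
  suffices h : c⁻¹ • ((waitingLaw lam).restrict {ω | ∀ y ∈ B, t < ω (y, 0)}).map (advance B t) =
      waitingLaw lam by
    rw [← h, smul_smul, ENNReal.mul_inv_cancel hc0 hct, one_smul, h]
  refine Measure.eq_infinitePi _ fun s A hA => ?_
  let A' : X × ℕ → Set ℝ := fun p => if p ∈ s then A p else Set.univ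
  have hA' : ∀ p, MeasurableSet (A' p) := fun p => by
    simp only [A']
    split_ifs
    exacts [hA p, .univ]
  let B' : Finset (X × ℕ) := B.image fun y => (y, 0)
  have hB' : ∀ p : X × ℕ, p ∈ B' ↔ p.1 ∈ B ∧ p.2 = 0 := by
    rintro ⟨y, j⟩
    simp only [B', Finset.mem_image, Prod.mk.injEq]
    constructor
    · rintro ⟨z, hz, rfl, rfl⟩
      exact ⟨hz, rfl⟩
    · rintro ⟨h, h'⟩
      exact ⟨y, h, rfl, h'.symm⟩
  let D : X × ℕ → Set ℝ := fun p => if p ∈ B' then {w | t < w ∧ w - t ∈ A' p} else A' p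
  have hD : ∀ p, MeasurableSet (D p) := fun p => by
    simp only [D]
    split_ifs
    · exact (measurableSet_lt measurable_const measurable_id).inter
        (measurable_id.sub_const t (hA' p))
    · exact hA' p
  have hset : advance B t ⁻¹' Set.pi s A ∩ {ω | ∀ y ∈ B, t < ω (y, 0)} =
      Set.pi ((s ∪ B' : Finset (X × ℕ)) : Set (X × ℕ)) D := by
    ext ω
    simp only [Set.mem_inter_iff, Set.mem_preimage, Set.mem_pi, Finset.mem_coe,
      Set.mem_ofPred_eq, Finset.mem_union]
    constructor
    · rintro ⟨h1, h2⟩ p hp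
      simp only [D, A', advance] at h1 ⊢
      by_cases hb : p ∈ B'
      · have hb2 := (hB' p).1 hb
        have h3 := h2 p.1 hb2.1
        rw [← hb2.2] at h3
        rw [if_pos hb]
        refine ⟨h3, ?_⟩
        split_ifs with hs
        · have := h1 p hs
          rwa [if_pos hb2] at this
        · trivial
      · rw [if_neg hb]
        split_ifs with hs
        · have := h1 p hs
          rwa [if_neg (fun H => hb ((hB' p).2 H))] at this
        · trivial
    · intro h
      refine ⟨fun p hp => ?_, fun y hy => ?_⟩
      · have := h p (Or.inl hp)
        simp only [D, A', if_pos hp] at this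
        rw [advance]
        by_cases hb : p ∈ B'
        · rw [if_pos hb] at this
          rw [if_pos ((hB' p).1 hb)]
          exact this.2
        · rw [if_neg hb] at this
          rwa [if_neg (fun H => hb ((hB' p).2 H))]
      · have hb : (y, 0) ∈ B' := (hB' _).2 ⟨hy, rfl⟩
        have := h (y, 0) (Or.inr hb)
        simp only [D, if_pos hb] at this
        exact this.1
  have hDm : ∀ p : X × ℕ, expMeasure (lam p.1) (D p) =
      (if p ∈ B' then ENNReal.ofReal (Real.exp (-(lam p.1 * t))) else 1) *
        expMeasure (lam p.1) (A' p) := by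
    intro p
    simp only [D]
    split_ifs
    · exact expMeasure_memoryless ht (hA' p)
    · rw [one_mul]
  rw [Measure.smul_apply, Measure.map_apply hm (.pi s.countable_toSet fun p _ => hA p),
    Measure.restrict_apply (hm (.pi s.countable_toSet fun p _ => hA p)), hset, waitingLaw,
    Measure.infinitePi_pi _ (fun i _ => hD i), Finset.prod_congr rfl fun p _ => hDm p,
    Finset.prod_mul_distrib]
  have h1 : ∏ p ∈ s ∪ B', (if p ∈ B' then ENNReal.ofReal (Real.exp (-(lam p.1 * t))) else 1) = c := by
    rw [Finset.prod_ite_mem, Finset.inter_eq_right.2 Finset.subset_union_right,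
      Finset.prod_image (by simp), ← ENNReal.ofReal_prod_of_nonneg (fun _ _ => Real.exp_nonneg _),
      ← Real.exp_sum, hc, Finset.sum_neg_distrib, Finset.sum_mul]
  have h2 : ∏ p ∈ s ∪ B', expMeasure (lam p.1) (A' p) = ∏ p ∈ s, expMeasure (lam p.1) (A p) := by
    rw [← Finset.prod_subset (Finset.subset_union_left (s₁ := s) (s₂ := B'))]
    · exact Finset.prod_congr rfl fun p hp => by simp [A', hp]
    · intro p _ hp
      simp [A', hp]
  rw [h1, h2, smul_eq_mul, ← mul_assoc, ENNReal.inv_mul_cancel hc0 hct, one_mul]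

lemma lintegral_advance (B : Finset X) {t : ℝ} (ht : 0 ≤ t) {Φ : (X × ℕ → ℝ) → ℝ≥0∞}
    (hΦ : Measurable Φ) :
    ∫⁻ ω in {ω | ∀ y ∈ B, t < ω (y, 0)}, Φ (advance B t ω) ∂(waitingLaw lam) =
      ENNReal.ofReal (Real.exp (-((∑ y ∈ B, lam y) * t))) * ∫⁻ ω, Φ ω ∂(waitingLaw lam) := by
  have hm : Measurable (advance B t) := (measurable_advance B).comp measurable_prodMk_left
  rw [← lintegral_map hΦ hm, map_advance lam B ht, lintegral_smul_measure, smul_eq_mul]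

lemma waitingLaw_forall_lt (B : Finset X) {t : ℝ} (ht : 0 ≤ t) :
    waitingLaw lam {ω | ∀ y ∈ B, t < ω (y, 0)} =
      ENNReal.ofReal (Real.exp (-((∑ y ∈ B, lam y) * t))) := by
  have := lintegral_advance lam B ht (Φ := fun _ => 1) measurable_const
  simpa using this

lemma ae_waitingLaw_pos [Countable X] : ∀ᵐ ω ∂(waitingLaw lam), ∀ p, 0 < ω p := by
  rw [ae_all_iff]
  intro p
  have h : (waitingLaw lam).map (fun ω => ω p) = expMeasure (lam p.1) :=
    Measure.infinitePi_map_eval _ p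
  have h2 := ae_expMeasure_pos (hlam.out p.1)
  rw [← h] at h2
  exact ae_of_ae_map (measurable_pi_apply p).aemeasurable h2

end Coordinates

lemma arrival_zero {X : Type*} (ω : X × ℕ → ℝ) (x : X) : arrival ω x 0 = ω (x, 0) := by
  simp [arrival]

/-- The earliest arrival at a point of `B`. -/
def minWait {X : Type*} (B : Finset X) (hB : B.Nonempty) (ω : X × ℕ → ℝ) : ℝ :=
  B.inf' hB fun y => ω (y, 0)

lemma measurable_minWait {X : Type*} (B : Finset X) (hB : B.Nonempty) :
    Measurable (minWait B hB) := by
  refine measurable_of_Iio fun a => ?_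
  have : minWait B hB ⁻¹' Set.Iio a = ⋃ y ∈ B, {ω | ω (y, 0) < a} := by
    ext ω
    simp [minWait]
  rw [this]
  exact Finset.measurableSet_biUnion _ fun y _ => measurableSet_lt (by fun_prop) (by fun_prop)

-- Regeneration at the first arrival

section Step

variable {X : Type*} [Fintype X] [Nonempty X]

/-- The location of the first request of the whole sequence. -/
def firstLoc (ω : X × ℕ → ℝ) : X := nextLoc ω fun _ => 0

/-- The arrival time of the first request of the whole sequence. -/
def firstGap (ω : X × ℕ → ℝ) : ℝ := ω (firstLoc ω, 0)

open Classical in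
/-- The waiting times seen immediately after the first arrival. -/
def shift (ω : X × ℕ → ℝ) : X × ℕ → ℝ := fun p =>
  if p.1 = firstLoc ω then ω (p.1, p.2 + 1) else if p.2 = 0 then ω p - firstGap ω else ω p

lemma firstGap_le (ω : X × ℕ → ℝ) (x : X) : firstGap ω ≤ ω (x, 0) := by
  have : arrival ω (firstLoc ω) 0 ≤ arrival ω x 0 :=
    Classical.choose_spec (Finite.exists_min fun x => arrival ω x 0) x
  rwa [arrival_zero, arrival_zero] at this

lemma firstLoc_eq {ω : X × ℕ → ℝ} {x : X} (h : ∀ y, y ≠ x → ω (x, 0) < ω (y, 0)) :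
    firstLoc ω = x := by
  by_contra hne
  exact absurd (h _ hne) (not_lt.2 (firstGap_le ω x))

/-- The choice in `nextLoc` depends only on the predicate of being a minimiser. Equal comparisons
therefore give equal choices even when there are ties. -/
lemma nextLoc_eq_nextLoc {ω ω' : X × ℕ → ℝ} {c c' : X → ℕ}
    (h : ∀ x y, arrival ω x (c x) ≤ arrival ω y (c y) ↔ arrival ω' x (c' x) ≤ arrival ω' y (c' y)) :
    nextLoc ω c = nextLoc ω' c' := by
  have h2 : (fun x₀ => ∀ x, arrival ω x₀ (c x₀) ≤ arrival ω x (c x)) =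
      fun x₀ => ∀ x, arrival ω' x₀ (c' x₀) ≤ arrival ω' x (c' x) := by
    funext x
    exact propext (forall_congr' fun y => h x y)
  unfold nextLoc
  congr

section

variable [MeasurableSpace X] 

/-- The chosen point is a function of the set of minimisers, which takes finitely many values and is
measurable in ω. -/
lemma measurable_firstLoc : Measurable (firstLoc (X := X)) := by
  classical
  let F : (X → Prop) → X := fun A => if h : ∃ x, A x then Classical.choose h else Classical.arbitrary X
  let P : (X × ℕ → ℝ) → X → Prop := fun ω x => ∀ y, arrival ω x 0 ≤ arrival ω y 0
  have hP : Measurable P := by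
    refine measurable_pi_iff.2 fun x => measurableSet_setOfPred.1 ?_
    simp only [P, arrival_zero, Set.ofPred_forall]
    exact MeasurableSet.iInter fun y => measurableSet_le (by fun_prop) (by fun_prop)
  have hF : Measurable F := measurable_of_finite F
  have : firstLoc (X := X) = F ∘ P := by
    funext ω
    have h : ∃ x, P ω x := Finite.exists_min fun x => arrival ω x 0
    simp only [Function.comp, F, dif_pos h]
    rfl
  rw [this]
  exact hF.comp hP

end

lemma firstGap_eq_minWait (ω : X × ℕ → ℝ) :
    firstGap ω = minWait Finset.univ Finset.univ_nonempty ω :=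
  le_antisymm (Finset.le_inf' _ _ fun x _ => firstGap_le ω x)
    (Finset.inf'_le _ (Finset.mem_univ _))

lemma measurable_firstGap : Measurable (firstGap (X := X)) := by
  rw [funext firstGap_eq_minWait]
  exact measurable_minWait _ _

lemma measurable_shift : Measurable (shift (X := X)) := by
  let _ : MeasurableSpace X := ⊤
  have h := measurable_firstLoc (X := X)
  have h' := measurable_firstGap (X := X)
  refine measurable_pi_iff.2 fun p => ?_
  unfold shift
  refine Measurable.ite (measurableSet_eq_fun measurable_const h) (by fun_prop) ?_
  split_ifs <;> fun_prop

variable (lam : X → ℝ) [hlam : Fact (∀ x, 0 < lam x)]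

lemma sum_lam_pos : 0 < ∑ x, lam x :=
  Finset.sum_pos (fun x _ => hlam.out x) Finset.univ_nonempty

/-- Condition on the first wait t at x. The other points exceed t with weight e^{-(Λ-λ_x)t}, and
their residual waits are fresh by `lintegral_advance`; tilting by this weight turns the law of t
into the exponential law of rate Λ, with factor λ_x/Λ. -/
lemma setLIntegral_strict (x : X) {Φ : ℝ × (X × ℕ → ℝ) → ℝ≥0∞} (hΦ : Measurable Φ) :
    ∫⁻ ω in {ω | ∀ y, y ≠ x → ω (x, 0) < ω (y, 0)}, Φ (firstGap ω, shift ω) ∂(waitingLaw lam) =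
      ENNReal.ofReal (lam x / ∑ y, lam y) *
        ∫⁻ t, ∫⁻ ω, Φ (t, ω) ∂(waitingLaw lam) ∂(expMeasure (∑ y, lam y)) := by
  classical
  let B : Finset X := Finset.univ.erase x
  have hB : ∀ y, y ∈ B ↔ y ≠ x := fun y => by simp [B]
  let E : Set (ℝ × (X × ℕ → ℝ)) := {q | ∀ y ∈ B, q.1 < q.2 (y, 0)}
  have hE : MeasurableSet E := by
    simp only [E, Set.ofPred_forall]
    exact MeasurableSet.iInter fun y => MeasurableSet.iInter fun _ =>
      measurableSet_lt (by fun_prop) (by fun_prop)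
  have hS : MeasurableSet {ω : X × ℕ → ℝ | ∀ y, y ≠ x → ω (x, 0) < ω (y, 0)} := by
    simp only [Set.ofPred_forall]
    exact MeasurableSet.iInter fun y => MeasurableSet.iInter fun _ =>
      measurableSet_lt (by fun_prop) (by fun_prop)
  have hm := measurable_advance B
  let Ψ : ℝ × (X × ℕ → ℝ) → ℝ≥0∞ := E.indicator fun q => Φ (q.1, advance B q.1 q.2)
  have hΨ : Measurable Ψ := (hΦ.comp (measurable_fst.prodMk hm)).indicator hE
  have h1 : ∫⁻ ω in {ω | ∀ y, y ≠ x → ω (x, 0) < ω (y, 0)}, Φ (firstGap ω, shift ω)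
        ∂(waitingLaw lam) = ∫⁻ ω, Ψ (ω (x, 0), dropFirst x ω) ∂(waitingLaw lam) := by
    rw [← lintegral_indicator hS]
    refine lintegral_congr fun ω => ?_
    have hiff : (ω (x, 0), dropFirst x ω) ∈ E ↔
        ω ∈ {ω : X × ℕ → ℝ | ∀ y, y ≠ x → ω (x, 0) < ω (y, 0)} := by
      simp only [E, hB, Set.mem_ofPred_eq]
      refine forall_congr' fun y => forall_congr' fun hy => ?_
      rw [dropFirst, if_neg hy]
    by_cases h : ω ∈ {ω : X × ℕ → ℝ | ∀ y, y ≠ x → ω (x, 0) < ω (y, 0)}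
    · rw [Set.indicator_of_mem h]
      simp only [Ψ]
      rw [Set.indicator_of_mem (hiff.2 h)]
      have hx : firstLoc ω = x := firstLoc_eq h
      have hg : firstGap ω = ω (x, 0) := by rw [firstGap, hx]
      congr 1
      refine Prod.ext hg ?_
      funext p
      simp only [shift, advance, dropFirst, hx, hg, hB]
      by_cases h1 : p.1 = x
      · simp [h1]
      · simp [h1]
    · rw [Set.indicator_of_notMem h]
      simp only [Ψ]
      rw [Set.indicator_of_notMem (fun H => h (hiff.1 H))]
  have hL := sum_lam_pos lam
  have hsum : ∑ y ∈ B, lam y = ∑ y, lam y - lam x := by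
    simp only [B]
    rw [← Finset.sum_erase_add _ _ (Finset.mem_univ x)]
    ring
  rw [h1, ← lintegral_map (f := Ψ) hΨ (Measurable.prodMk (by fun_prop) (measurable_dropFirst x)),
    map_dropFirst, lintegral_prod _ hΨ.aemeasurable,
    ← lintegral_expMeasure_tilt (hlam.out x) hL _ (hΦ.lintegral_prod_right' (ν := waitingLaw lam))]
  refine lintegral_congr_ae ?_
  filter_upwards [ae_expMeasure_pos (hlam.out x)] with t ht
  rw [← hsum, ← lintegral_advance lam B ht.le (Φ := fun ω => Φ (t, ω))
    (hΦ.comp measurable_prodMk_left), ← lintegral_indicator]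
  · rfl
  · simp only [Set.ofPred_forall]
    exact MeasurableSet.iInter fun y => MeasurableSet.iInter fun _ =>
      measurableSet_lt (by fun_prop) (by fun_prop)

/-- The winning probabilities λ_x/Λ of the disjoint events "x strictly wins" sum to 1. -/
lemma ae_exists_strict :
    ∀ᵐ ω ∂(waitingLaw lam), ∃ x, ∀ y, y ≠ x → ω (x, 0) < ω (y, 0) := by
  have hL := sum_lam_pos lam
  have := isProbabilityMeasure_expMeasure hL
  have hS : ∀ x, MeasurableSet {ω : X × ℕ → ℝ | ∀ y, y ≠ x → ω (x, 0) < ω (y, 0)} := by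
    intro x
    simp only [Set.ofPred_forall]
    exact MeasurableSet.iInter fun y => MeasurableSet.iInter fun _ =>
      measurableSet_lt (by fun_prop) (by fun_prop)
  have hU : {ω : X × ℕ → ℝ | ∃ x, ∀ y, y ≠ x → ω (x, 0) < ω (y, 0)} =
      ⋃ x, {ω : X × ℕ → ℝ | ∀ y, y ≠ x → ω (x, 0) < ω (y, 0)} := Set.ofPred_exists _
  refine (mem_ae_iff_prob_eq_one (hU ▸ MeasurableSet.iUnion hS)).2 ?_
  rw [hU, measure_iUnion _ hS, tsum_fintype]
  · have h : ∀ x, waitingLaw lam {ω : X × ℕ → ℝ | ∀ y, y ≠ x → ω (x, 0) < ω (y, 0)} =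
        ENNReal.ofReal (lam x / ∑ y, lam y) := fun x => by
      simpa using setLIntegral_strict lam x (Φ := fun _ => 1) measurable_const
    simp only [h]
    rw [← ENNReal.ofReal_sum_of_nonneg fun x _ => div_nonneg (hlam.out x).le hL.le,
      ← Finset.sum_div, div_self hL.ne', ENNReal.ofReal_one]
  · intro x y hxy
    refine Set.disjoint_left.2 fun ω h1 h2 => ?_
    exact lt_asymm (h1 y hxy.symm) (h2 x hxy)

lemma lintegral_step {Φ : X → ℝ × (X × ℕ → ℝ) → ℝ≥0∞} (hΦ : ∀ x, Measurable (Φ x)) :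
    ∫⁻ ω, Φ (firstLoc ω) (firstGap ω, shift ω) ∂(waitingLaw lam) =
      ∑ x, ENNReal.ofReal (lam x / ∑ y, lam y) *
        ∫⁻ t, ∫⁻ ω, Φ x (t, ω) ∂(waitingLaw lam) ∂(expMeasure (∑ y, lam y)) := by
  have hS : ∀ x, MeasurableSet {ω : X × ℕ → ℝ | ∀ y, y ≠ x → ω (x, 0) < ω (y, 0)} := by
    intro x
    simp only [Set.ofPred_forall]
    exact MeasurableSet.iInter fun y => MeasurableSet.iInter fun _ =>
      measurableSet_lt (by fun_prop) (by fun_prop)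
  have hU : (⋃ x, {ω : X × ℕ → ℝ | ∀ y, y ≠ x → ω (x, 0) < ω (y, 0)} : Set (X × ℕ → ℝ)) =ᵐ[waitingLaw lam]
      Set.univ := by
    filter_upwards [ae_exists_strict lam] with ω hω
    exact propext ⟨fun _ => trivial, fun _ => Set.mem_iUnion.2 hω⟩
  rw [← setLIntegral_univ, ← setLIntegral_congr hU, lintegral_iUnion hS, tsum_fintype]
  · refine Finset.sum_congr rfl fun x _ => ?_
    rw [← setLIntegral_strict lam x (hΦ x)]
    refine setLIntegral_congr_fun (hS x) fun ω hω => ?_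
    simp only [firstLoc_eq hω]
  · intro x y hxy
    refine Set.disjoint_left.2 fun ω h1 h2 => ?_
    exact lt_asymm (h1 y hxy.symm) (h2 x hxy)

lemma lintegral_step_indep {Φ : X → ℝ × (X × ℕ → ℝ) → ℝ≥0∞} (hΦ : ∀ x, Measurable (Φ x)) :
    ∫⁻ ω, Φ (firstLoc ω) (firstGap ω, shift ω) ∂(waitingLaw lam) =
      ∫⁻ ω, ∫⁻ ω', Φ (firstLoc ω) (firstGap ω, ω') ∂(waitingLaw lam) ∂(waitingLaw lam) := by
  rw [lintegral_step lam hΦ, lintegral_step lam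
    (Φ := fun x q => ∫⁻ ω', Φ x (q.1, ω') ∂(waitingLaw lam))]
  · simp
  · intro x
    exact ((hΦ x).lintegral_prod_right' (ν := waitingLaw lam)).comp measurable_fst

lemma measurePreserving_shift : MeasurePreserving shift (waitingLaw lam) (waitingLaw lam) := by
  refine ⟨measurable_shift, Measure.ext fun A hA => ?_⟩
  rw [Measure.map_apply measurable_shift hA, ← lintegral_indicator_one (measurable_shift hA),
    ← lintegral_indicator_one hA]
  have hm : Measurable (A.indicator (1 : (X × ℕ → ℝ) → ℝ≥0∞)) := measurable_one.indicator hA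
  have := lintegral_step_indep lam (Φ := fun _ q => A.indicator 1 q.2)
    (fun _ => hm.comp measurable_snd)
  simp only [lintegral_const, measure_univ, mul_one] at this
  exact this

lemma measurable_shift_iterate (n : ℕ) : Measurable (shift (X := X))^[n] :=
  measurable_shift.iterate n

lemma ae_forall_iterate_shift {p : (X × ℕ → ℝ) → Prop} (hp : ∀ᵐ ω ∂(waitingLaw lam), p ω) :
    ∀ᵐ ω ∂(waitingLaw lam), ∀ n, p (shift^[n] ω) :=
  ae_all_iff.2 fun n => ((measurePreserving_shift lam).iterate n).quasiMeasurePreserving.ae hp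

lemma lintegral_iterate_shift (n : ℕ) {Φ : (X × ℕ → ℝ) → ℝ≥0∞} (hΦ : Measurable Φ) :
    ∫⁻ ω, Φ (shift^[n] ω) ∂(waitingLaw lam) = ∫⁻ ω, Φ ω ∂(waitingLaw lam) :=
  ((measurePreserving_shift lam).iterate n).lintegral_comp hΦ

/-- A state updated at each arrival by means of its location and the preceding gap. -/
def state {Z : Type*} (z₀ : Z) (g : X → Z × ℝ → Z) : ℕ → (X × ℕ → ℝ) → Z
  | 0, _ => z₀
  | n + 1, ω => g (firstLoc (shift^[n] ω)) (state z₀ g n ω, firstGap (shift^[n] ω))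

lemma measurable_state {Z : Type*} [MeasurableSpace Z] (z₀ : Z) {g : X → Z × ℝ → Z}
    (hg : ∀ x, Measurable (g x)) (n : ℕ) : Measurable (state z₀ g n) := by
  let _ : MeasurableSpace X := ⊤
  have : Countable X := Finite.to_countable
  induction n with
  | zero => exact measurable_const
  | succ n ih =>
    have h1 := measurable_shift_iterate (X := X) n
    have h2 : Measurable fun q : (Z × ℝ) × X => g q.2 q.1 :=
      measurable_from_prod_countable_left hg
    exact h2.comp ((ih.prodMk (measurable_firstGap.comp h1)).prodMk (measurable_firstLoc.comp h1))

/-- The Markov property at the n-th arrival: a state built from the first n locations and gaps is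
independent of the future, which has the original law. Induction on n, with one regeneration step
each. -/
lemma lintegral_state {Z : Type*} [MeasurableSpace Z] (z₀ : Z) {g : X → Z × ℝ → Z}
    (hg : ∀ x, Measurable (g x)) (n : ℕ) {Φ : Z × (X × ℕ → ℝ) → ℝ≥0∞} (hΦ : Measurable Φ) :
    ∫⁻ ω, Φ (state z₀ g n ω, shift^[n] ω) ∂(waitingLaw lam) =
      ∫⁻ ω, ∫⁻ ω', Φ (state z₀ g n ω, ω') ∂(waitingLaw lam) ∂(waitingLaw lam) := by
  let _ : MeasurableSpace X := ⊤
  have : Countable X := Finite.to_countable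
  have h2 : Measurable fun q : (Z × ℝ) × X => g q.2 q.1 :=
    measurable_from_prod_countable_left hg
  induction n generalizing Φ with
  | zero => simp [state]
  | succ n ih =>
    have hU : Measurable fun q : Z × (X × ℕ → ℝ) => g (firstLoc q.2) (q.1, firstGap q.2) :=
      h2.comp ((measurable_fst.prodMk (measurable_firstGap.comp measurable_snd)).prodMk
        (measurable_firstLoc.comp measurable_snd))
    have hΦ' := hΦ.lintegral_prod_right' (ν := waitingLaw lam)
    have e1 := ih (Φ := fun q => Φ (g (firstLoc q.2) (q.1, firstGap q.2), shift q.2))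
      (hΦ.comp (hU.prodMk (measurable_shift.comp measurable_snd)))
    have e2 := ih (Φ := fun q => ∫⁻ ω', Φ (g (firstLoc q.2) (q.1, firstGap q.2), ω')
      ∂(waitingLaw lam)) (hΦ'.comp hU)
    simp only [Function.iterate_succ_apply', state]
    rw [e1, e2]
    refine lintegral_congr fun ω => ?_
    exact lintegral_step_indep lam (Φ := fun x q => Φ (g x (state z₀ g n ω, q.1), q.2))
      (fun x => hΦ.comp (((hg x).comp (measurable_const.prodMk measurable_fst)).prodMk
        measurable_snd))

end Step

-- The first arrival in a set of points

section MinWait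

variable {X : Type*} (lam : X → ℝ) [hlam : Fact (∀ x, 0 < lam x)]

lemma map_minWait (B : Finset X) (hB : B.Nonempty) :
    (waitingLaw lam).map (minWait B hB) = expMeasure (∑ y ∈ B, lam y) := by
  have hL : 0 < ∑ y ∈ B, lam y := Finset.sum_pos (fun x _ => hlam.out x) hB
  have := isProbabilityMeasure_expMeasure hL
  have := Measure.isProbabilityMeasure_map (μ := waitingLaw lam)
    (measurable_minWait B hB).aemeasurable
  have key : ∀ t, 0 ≤ t → (waitingLaw lam).map (minWait B hB) (Set.Ioi t) =
      expMeasure (∑ y ∈ B, lam y) (Set.Ioi t) := by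
    intro t ht
    rw [Measure.map_apply (measurable_minWait B hB) measurableSet_Ioi, expMeasure_Ioi hL ht,
      ← waitingLaw_forall_lt lam B ht]
    congr 1
    ext ω
    simp [minWait]
  refine Measure.ext_of_Iic _ _ fun t => ?_
  rw [← Set.compl_Ioi, prob_compl_eq_one_sub measurableSet_Ioi,
    prob_compl_eq_one_sub measurableSet_Ioi]
  rcases le_total 0 t with ht | ht
  · rw [key t ht]
  · have h1 : expMeasure (∑ y ∈ B, lam y) (Set.Ioi 0) = 1 := by
      simp [expMeasure_Ioi hL le_rfl]
    have h2 := key 0 le_rfl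
    have hs : Set.Ioi (0 : ℝ) ⊆ Set.Ioi t := Set.Ioi_subset_Ioi ht
    rw [le_antisymm prob_le_one ((h2.trans h1) ▸ measure_mono hs),
      le_antisymm prob_le_one (h1 ▸ measure_mono hs)]

end MinWait

-- The request sequence in terms of the shift

section Requests

variable {X : Type*} [Fintype X] [Nonempty X]

/-- The sum of the first `n` gaps of the whole sequence. -/
def epoch (n : ℕ) (ω : X × ℕ → ℝ) : ℝ := ∑ j ∈ Finset.range n, firstGap (shift^[j] ω)

lemma epoch_zero (ω : X × ℕ → ℝ) : epoch 0 ω = 0 := by simp [epoch]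

lemma epoch_succ (n : ℕ) (ω : X × ℕ → ℝ) :
    epoch (n + 1) ω = epoch n ω + firstGap (shift^[n] ω) := Finset.sum_range_succ _ _

lemma epoch_add (a b : ℕ) (ω : X × ℕ → ℝ) :
    epoch (a + b) ω = epoch a ω + epoch b (shift^[a] ω) := by
  simp only [epoch, Finset.sum_range_add, ← Function.iterate_add_apply, add_comm]

lemma measurable_epoch (n : ℕ) : Measurable (epoch n (X := X)) :=
  Finset.measurable_sum _ fun j _ => measurable_firstGap.comp (measurable_shift_iterate j)

open Classical in
lemma arrival_shift (ω : X × ℕ → ℝ) (x : X) (i : ℕ) :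
    arrival (shift ω) x i =
      arrival ω x (i + if x = firstLoc ω then 1 else 0) - firstGap ω := by
  split_ifs with h
  · rw [arrival, arrival, Finset.sum_range_succ' _ (i + 1)]
    simp [shift, h, firstGap]
  · rw [arrival, arrival, Finset.sum_range_succ', add_zero, Finset.sum_range_succ' _ i]
    simp [shift, h]
    ring

/-- The bridge from the counting definition of `requests` to the iterated shift: after k arrivals,
indices restart at `counts ω k` and times at `epoch k ω`. -/
lemma arrival_shift_iterate (ω : X × ℕ → ℝ) (k : ℕ) :
    ∀ x i, arrival (shift^[k] ω) x i = arrival ω x (counts ω k x + i) - epoch k ω := by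
  classical
  induction k with
  | zero => simp [counts, epoch_zero]
  | succ k ih =>
    intro x i
    have hloc : nextLoc ω (counts ω k) = firstLoc (shift^[k] ω) :=
      nextLoc_eq_nextLoc fun x y => by simp [ih]
    rw [Function.iterate_succ_apply', arrival_shift, ih, epoch_succ, counts, hloc]
    by_cases hx : x = firstLoc (shift^[k] ω)
    · rw [if_pos hx, ← hx, Function.update_self, sub_sub]
      congr 2
      ring
    · rw [if_neg hx, Function.update_of_ne hx, sub_sub, add_zero]

lemma nextLoc_counts (ω : X × ℕ → ℝ) (k : ℕ) :
    nextLoc ω (counts ω k) = firstLoc (shift^[k] ω) :=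
  nextLoc_eq_nextLoc fun x y => by simp [arrival_shift_iterate]

lemma requests_eq (ω : X × ℕ → ℝ) (m : ℕ) (k : Fin m) :
    requests ω m k = ⟨firstLoc (shift^[k] ω), epoch (k + 1) ω⟩ := by
  have h := arrival_shift_iterate ω k (firstLoc (shift^[k] ω)) 0
  rw [arrival_zero, add_zero] at h
  rw [requests, nextLoc_counts]
  congr 1
  rw [epoch_succ, firstGap, h]
  ring

lemma requests_loc (ω : X × ℕ → ℝ) (m : ℕ) (k : Fin m) :
    (requests ω m k).loc = firstLoc (shift^[k] ω) := by rw [requests_eq]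

lemma requests_time (ω : X × ℕ → ℝ) (m : ℕ) (k : Fin m) :
    (requests ω m k).time = epoch (k + 1) ω := by rw [requests_eq]

lemma epoch_strictMono {ω : X × ℕ → ℝ} (hω : ∀ n p, 0 < (shift^[n] ω) p) :
    StrictMono fun n => epoch n ω :=
  strictMono_nat_of_lt_succ fun n => by
    rw [epoch_succ]
    exact lt_add_of_pos_right _ (hω n _)

/-- While nothing arrives at y, each shift transfers the gap from the residual wait at y to the
epoch, so their sum, the absolute time of the next arrival at y, stays constant. -/
lemma exists_next_arrival {ω : X × ℕ → ℝ} (hω : ∀ n p, 0 < (shift^[n] ω) p) (y : X) {n m : ℕ}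
    (hnm : n ≤ m) :
    (∃ k, n ≤ k ∧ k < m ∧ firstLoc (shift^[k] ω) = y ∧
      epoch (k + 1) ω = epoch n ω + (shift^[n] ω) (y, 0)) ∨
    epoch m ω < epoch n ω + (shift^[n] ω) (y, 0) := by
  have h : (∃ k, n ≤ k ∧ k < m ∧ firstLoc (shift^[k] ω) = y ∧
      epoch (k + 1) ω = epoch n ω + (shift^[n] ω) (y, 0)) ∨
      epoch m ω + (shift^[m] ω) (y, 0) = epoch n ω + (shift^[n] ω) (y, 0) := by
    induction m, hnm using Nat.le_induction with
    | base => exact Or.inr rfl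
    | succ m hnm ih =>
      rcases ih with ⟨k, h1, h2, h3⟩ | ih
      · exact Or.inl ⟨k, h1, h2.trans (Nat.lt_succ_self m), h3⟩
      · by_cases hy : firstLoc (shift^[m] ω) = y
        · refine Or.inl ⟨m, hnm, Nat.lt_succ_self m, hy, ?_⟩
          rw [epoch_succ, firstGap, hy, ih]
        · refine Or.inr ?_
          rw [← ih, epoch_succ, Function.iterate_succ_apply']
          have : shift (shift^[m] ω) (y, 0) = (shift^[m] ω) (y, 0) - firstGap (shift^[m] ω) := by
            simp [shift, Ne.symm hy]
          rw [this]
          ring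
  refine h.imp_right fun h => ?_
  rw [← h]
  exact lt_add_of_pos_right _ (hω m _)

lemma ae_shift_pos (lam : X → ℝ) [Fact (∀ x, 0 < lam x)] :
    ∀ᵐ ω ∂(waitingLaw lam), ∀ n p, 0 < (shift^[n] ω) p :=
  have : Countable X := Finite.to_countable
  ae_forall_iterate_shift lam (ae_waitingLaw_pos lam)

end Requests

-- The radius and the half-radius window

section Radius

variable {X : Type*} [Fintype X] [MetricSpace X] (lam : X → ℝ)

open Classical in
/-- The closed ball as a finset. -/
def ballFinset (x : X) (u : ℝ≥0∞) : Finset X := {y | edist x y ≤ u}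

lemma mem_ballFinset {x y : X} {u : ℝ≥0∞} : y ∈ ballFinset x u ↔ edist x y ≤ u := by
  simp [ballFinset]

lemma ballFinset_nonempty (x : X) (u : ℝ≥0∞) : (ballFinset x u).Nonempty :=
  ⟨x, by simp [mem_ballFinset]⟩

lemma ballRate_eq (x : X) (u : ℝ≥0∞) : ballRate lam x u = ∑ y ∈ ballFinset x u, lam y := rfl

/-- The infimum is attained: closed balls in a finite space do not change under a small enough
increase of the radius. -/
lemma lintegral_le_radius (f : ℝ → ℝ) (x : X) :
    ∫⁻ t, ENNReal.ofReal (f t) ∂(expMeasure (ballRate lam x (radius f lam x))) ≤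
      radius f lam x := by
  classical
  by_contra! hlt
  set ρ := radius f lam x with hρ
  -- For a radius in [ρ, c) the ball is that of ρ, yet the radius is still below the mean delay cost
  -- for this ball.
  let c := min (Finset.inf {y | ρ < edist x y} fun y => edist x y)
    (∫⁻ t, ENNReal.ofReal (f t) ∂(expMeasure (ballRate lam x ρ)))
  have hc : ρ < c := by
    refine lt_min ((Finset.lt_inf_iff (lt_top_of_lt hlt)).2 fun y hy => ?_) hlt
    simpa using hy
  obtain ⟨u, hu, huc⟩ := sInf_lt_iff.1 (show sInf _ < c from hc)
  have hle : ρ ≤ u := sInf_le hu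
  have hball : ballRate lam x u = ballRate lam x ρ := by
    rw [ballRate_eq, ballRate_eq]
    congr 1
    ext y
    rw [mem_ballFinset, mem_ballFinset]
    refine ⟨fun h => ?_, fun h => h.trans hle⟩
    by_contra! h'
    have : c ≤ edist x y := (min_le_left _ _).trans (Finset.inf_le (by simpa using h'))
    exact absurd (h.trans_lt huc) (not_lt.2 this)
  have hu' : ∫⁻ t, ENNReal.ofReal (f t) ∂(expMeasure (ballRate lam x u)) ≤ u := hu
  rw [hball] at hu'
  exact absurd (hu'.trans_lt huc) (not_lt.2 (min_le_right _ _))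

lemma lt_lintegral_of_lt_radius {f : ℝ → ℝ} {x : X} {u : ℝ≥0∞} (h : u < radius f lam x) :
    u < ∫⁻ t, ENNReal.ofReal (f t) ∂(expMeasure (ballRate lam x u)) := by
  by_contra! h'
  exact absurd h (not_lt.2 (sInf_le h'))

variable [hlam : Fact (∀ x, 0 < lam x)]

lemma le_ballRate (x : X) (u : ℝ≥0∞) : lam x ≤ ballRate lam x u := by
  rw [ballRate_eq]
  exact Finset.single_le_sum (f := lam) (fun y _ => (hlam.out y).le)
    (mem_ballFinset.2 (by simp))

lemma ballRate_pos (x : X) (u : ℝ≥0∞) : 0 < ballRate lam x u :=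
  (hlam.out x).trans_le (le_ballRate lam x u)

lemma radius_ne_top {α : ℝ} (hα : 0 ≤ α) (x : X) : radius (fun t : ℝ => t ^ α) lam x ≠ ⊤ := by
  refine ne_top_of_le_ne_top (ENNReal.ofReal_ne_top (r := Real.Gamma (α + 1) / lam x ^ α))
    (sInf_le ?_)
  refine Set.mem_ofPred_eq ▸ ?_
  rw [lintegral_rpow_expMeasure (ballRate_pos lam _ _) hα]
  refine ENNReal.ofReal_le_ofReal ?_
  have := Real.rpow_pos_of_pos (hlam.out x) α
  have := Real.Gamma_pos_of_pos (show 0 < α + 1 by linarith)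
  gcongr
  · exact (hlam.out x).le
  · exact le_ballRate lam x _

lemma radius_pos {α : ℝ} (hα : 0 ≤ α) (x : X) : 0 < radius (fun t : ℝ => t ^ α) lam x := by
  refine lt_of_lt_of_le ?_ (lintegral_le_radius lam _ x)
  rw [lintegral_rpow_expMeasure (ballRate_pos lam _ _) hα, ENNReal.ofReal_pos]
  have := Real.rpow_pos_of_pos (ballRate_pos lam x (radius (fun t : ℝ => t ^ α) lam x)) α
  have := Real.Gamma_pos_of_pos (show 0 < α + 1 by linarith)
  positivity

/-- Waiting for τ already costs half the radius, while the half-radius ball expects at most 1 + α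
arrivals in time τ. This is where minimality of the radius enters the lower bound. -/
lemma exists_window {α : ℝ} (hα : 0 ≤ α) (x : X) : ∃ τ : ℝ, 0 ≤ τ ∧
    (∀ t, τ ≤ t → (radius (fun t : ℝ => t ^ α) lam x).toReal / 2 ≤ t ^ α) ∧
    ballRate lam x (radius (fun t : ℝ => t ^ α) lam x / 2) * τ ≤ 1 + α := by
  set ρ := radius (fun t : ℝ => t ^ α) lam x with hρ
  have h0 : 0 < ρ := radius_pos lam hα x
  have ht : ρ ≠ ⊤ := radius_ne_top lam hα x
  have h := lt_lintegral_of_lt_radius lam (ENNReal.half_lt_self h0.ne' ht)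
  set b := ballRate lam x (ρ / 2) with hb
  have hb0 : 0 < b := ballRate_pos lam _ _
  rw [lintegral_rpow_expMeasure hb0 hα] at h
  have h' : ρ.toReal / 2 < Real.Gamma (α + 1) / b ^ α := by
    have := (ENNReal.lt_ofReal_iff_toReal_lt (ne_top_of_lt h)).1 h
    simpa using this
  have hr0 : 0 < ρ.toReal := ENNReal.toReal_pos h0.ne' ht
  have hbα := Real.rpow_pos_of_pos hb0 α
  rcases hα.eq_or_lt with rfl | hα'
  -- For α = 0 the delay cost is constantly 1 and ρ/2 < Γ(1) = 1, so no waiting is needed.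
  · refine ⟨0, le_rfl, fun t _ => ?_, by simp⟩
    simp only [zero_add, Real.Gamma_one, Real.rpow_zero, div_one] at h' ⊢
    exact h'.le
  · refine ⟨(ρ.toReal / 2) ^ α⁻¹, by positivity, fun t ht => ?_, ?_⟩
    · calc ρ.toReal / 2 = ((ρ.toReal / 2) ^ α⁻¹) ^ α := by
            rw [Real.rpow_inv_rpow (by positivity) hα'.ne']
        _ ≤ t ^ α := Real.rpow_le_rpow (by positivity) ht hα
    · rw [add_comm 1 α]
      refine (Real.rpow_le_rpow_iff (by positivity) (by linarith) hα').1 ?_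
      rw [Real.mul_rpow hb0.le (by positivity), Real.rpow_inv_rpow (by positivity) hα'.ne']
      refine le_trans ?_ (Gamma_add_one_le_rpow hα)
      rw [lt_div_iff₀ hbα] at h'
      linarith

end Radius

-- Time since the last arrival in a set

lemma measurableSet_forall_lt {X : Type*} (B : Finset X) (r : ℝ) :
    MeasurableSet {ω : X × ℕ → ℝ | ∀ y ∈ B, r < ω (y, 0)} := by
  simp only [Set.ofPred_forall]
  exact B.measurableSet_biInter fun y _ => measurableSet_lt (by fun_prop) (by fun_prop)

open Classical in
/-- Update of the time elapsed since the last arrival in `B`. -/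
def ageUpdate {X : Type*} (B : Finset X) (x : X) (q : ℝ × ℝ) : ℝ := if x ∈ B then 0 else q.1 + q.2

lemma measurable_ageUpdate {X : Type*} (B : Finset X) (x : X) : Measurable (ageUpdate B x) := by
  unfold ageUpdate
  split_ifs <;> fun_prop

section Age

variable {X : Type*} [Fintype X] [Nonempty X]

/-- The time elapsed since the last arrival in `B` at the moment of the `n`-th arrival, where
this time is taken to be `z` in the beginning. -/
def age (B : Finset X) (z : ℝ) (n : ℕ) (ω : X × ℕ → ℝ) : ℝ := state z (ageUpdate B) n ω

lemma age_le {ω : X × ℕ → ℝ} (B : Finset X) (z : ℝ) {j n : ℕ}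
    (hω : ∀ n p, 0 < (shift^[n] ω) p) (hjn : j < n) (hj : firstLoc (shift^[j] ω) ∈ B) :
    age B z n ω ≤ epoch n ω - epoch (j + 1) ω := by
  induction n, (hjn : j + 1 ≤ n) using Nat.le_induction with
  | base => simp [age, state, ageUpdate, hj]
  | succ n hn ih =>
    have h1 := ih
    have h2 := (epoch_strictMono hω).monotone (Nat.le_succ_of_le hn)
    rw [age, state, ageUpdate]
    split_ifs with h
    · linarith
    · rw [epoch_succ]
      rw [age] at h1
      linarith

lemma next_arrival_mono {ω : X × ℕ → ℝ} (hω : ∀ n p, 0 < (shift^[n] ω) p) (y : X) {n m : ℕ}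
    (hnm : n ≤ m) :
    epoch n ω + (shift^[n] ω) (y, 0) ≤ epoch m ω + (shift^[m] ω) (y, 0) := by
  induction m, hnm using Nat.le_induction with
  | base => exact le_rfl
  | succ m hnm ih =>
    refine ih.trans ?_
    by_cases hy : firstLoc (shift^[m] ω) = y
    · have h := hω (m + 1) (y, 0)
      rw [epoch_succ, firstGap, hy]
      linarith
    · rw [epoch_succ, Function.iterate_succ_apply']
      have : shift (shift^[m] ω) (y, 0) = (shift^[m] ω) (y, 0) - firstGap (shift^[m] ω) := by
        simp [shift, Ne.symm hy]
      rw [this]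
      linarith

variable (lam : X → ℝ) [hlam : Fact (∀ x, 0 < lam x)]

/-- The left side is the probability of no arrival in B up to time σ. Split by the first arrival of
all: if it is in B, its gap must be at least σ; otherwise B must stay empty for the remaining time σ
- s. -/
lemma exp_le_sum_lintegral (B : Finset X) (σ : ℝ) :
    ENNReal.ofReal (Real.exp (-((∑ y ∈ B, lam y) * max σ 0))) ≤
      ∑ x, ENNReal.ofReal (lam x / ∑ y, lam y) * ∫⁻ s, (open Classical in
        if x ∈ B then (Set.Ici σ).indicator 1 s else
          ENNReal.ofReal (Real.exp (-((∑ y ∈ B, lam y) * max (σ - s) 0))))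
        ∂(expMeasure (∑ y, lam y)) := by
  classical
  let S : Set (ℝ × (X × ℕ → ℝ)) := {q | ∀ y ∈ B, max (σ - q.1) 0 < q.2 (y, 0)}
  have hS : MeasurableSet S := by
    simp only [S, Set.ofPred_forall]
    exact MeasurableSet.iInter fun y => MeasurableSet.iInter fun _ =>
      measurableSet_lt (by fun_prop) (by fun_prop)
  have hT' : ∀ r : ℝ, MeasurableSet {ω : X × ℕ → ℝ | ∀ y ∈ B, r < ω (y, 0)} := fun r =>
    measurableSet_forall_lt B r
  have hT := hT' (max σ 0)
  let Φ : X → ℝ × (X × ℕ → ℝ) → ℝ≥0∞ := fun x q =>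
    if x ∈ B then (Set.Ici σ).indicator 1 q.1 else S.indicator 1 q
  have hΦ : ∀ x, Measurable (Φ x) := fun x => by
    simp only [Φ]
    split_ifs
    · exact (measurable_one.indicator measurableSet_Ici).comp measurable_fst
    · exact measurable_one.indicator hS
  have h1 : ENNReal.ofReal (Real.exp (-((∑ y ∈ B, lam y) * max σ 0))) ≤
      ∫⁻ ω, Φ (firstLoc ω) (firstGap ω, shift ω) ∂(waitingLaw lam) := by
    rw [← waitingLaw_forall_lt lam B (le_max_right σ 0), ← lintegral_indicator_one hT]
    refine lintegral_mono_ae ?_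
    filter_upwards [ae_shift_pos lam] with ω hω
    by_cases hω' : ω ∈ {ω : X × ℕ → ℝ | ∀ y ∈ B, max σ 0 < ω (y, 0)}
    · rw [Set.indicator_of_mem hω']
      simp only [Φ]
      split_ifs with hx
      · rw [Set.indicator_of_mem]
        · rfl
        · exact ((le_max_left σ 0).trans_lt (hω' _ hx)).le
      · rw [Set.indicator_of_mem]
        · rfl
        · intro y hy
          have hne : y ≠ firstLoc ω := fun h => hx (h ▸ hy)
          have h2 := hω' y hy
          have h3 := hω 1 (y, 0)
          simp only [Function.iterate_one] at h3
          have h4 : shift ω (y, 0) = ω (y, 0) - firstGap ω := by simp [shift, hne]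
          refine max_lt ?_ h3
          change σ - firstGap ω < shift ω (y, 0)
          rw [h4]
          linarith [le_max_left σ 0]
    · rw [Set.indicator_of_notMem hω']
      exact zero_le
  refine h1.trans ?_
  rw [lintegral_step lam hΦ]
  refine Finset.sum_le_sum fun x _ => mul_le_mul_right ?_ _
  refine lintegral_mono fun s => ?_
  simp only [Φ]
  split_ifs with hx
  · simp
  · have : ∀ ω, S.indicator (1 : ℝ × (X × ℕ → ℝ) → ℝ≥0∞) (s, ω) =
        {ω : X × ℕ → ℝ | ∀ y ∈ B, max (σ - s) 0 < ω (y, 0)}.indicator 1 ω := fun ω => rfl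
    simp only [this]
    rw [lintegral_indicator_one (hT' _), waitingLaw_forall_lt _ _ (le_max_right _ _)]

/-- Looking back from the n-th arrival, the time since the last arrival in B has at least an
exponential tail. A fictitious initial age z ≥ σ makes this uniform in n, including the first
requests. The induction is on the tail bound for all σ at once, because an arrival outside B
replaces σ by σ - s. -/
lemma exp_le_lintegral_age (B : Finset X) (z : ℝ) (n : ℕ) :
    ∀ σ ≤ z, ENNReal.ofReal (Real.exp (-((∑ y ∈ B, lam y) * max σ 0))) ≤
      ∫⁻ ω, ∫⁻ t, (Set.Ici σ).indicator 1 (age B z n ω + t) ∂(expMeasure (∑ y, lam y))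
        ∂(waitingLaw lam) := by
  classical
  have hb : 0 ≤ ∑ y ∈ B, lam y := Finset.sum_nonneg fun y _ => (hlam.out y).le
  have hL := sum_lam_pos lam
  have := isProbabilityMeasure_expMeasure hL
  have hI : ∀ σ : ℝ, Measurable ((Set.Ici σ).indicator (1 : ℝ → ℝ≥0∞)) := fun σ =>
    measurable_one.indicator measurableSet_Ici
  have hq : ∀ σ : ℝ, Measurable fun z : ℝ =>
      ∫⁻ t, (Set.Ici σ).indicator (1 : ℝ → ℝ≥0∞) (z + t) ∂(expMeasure (∑ y, lam y)) := fun σ =>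
    ((hI σ).comp (measurable_fst.add measurable_snd)).lintegral_prod_right'
      (f := fun q : ℝ × ℝ => (Set.Ici σ).indicator (1 : ℝ → ℝ≥0∞) (q.1 + q.2))
  have hage : ∀ n, Measurable (age B z n) := fun n => measurable_state z (measurable_ageUpdate B) n
  induction n with
  | zero =>
    intro σ hσ
    have h1 : ∀ ω : X × ℕ → ℝ, ∫⁻ t, (Set.Ici σ).indicator 1 (age B z 0 ω + t)
        ∂(expMeasure (∑ y, lam y)) = 1 := fun ω => by
      have : ∀ᵐ t ∂(expMeasure (∑ y, lam y)),
          (Set.Ici σ).indicator (1 : ℝ → ℝ≥0∞) (age B z 0 ω + t) = 1 := by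
        filter_upwards [ae_expMeasure_pos hL] with t ht
        rw [Set.indicator_of_mem]
        · rfl
        · simp only [age, state, Set.mem_Ici]
          linarith
      rw [lintegral_congr_ae this]
      simp
    simp only [h1]
    simp only [lintegral_const, measure_univ, mul_one, ENNReal.ofReal_le_one, Real.exp_le_one_iff]
    have : 0 ≤ (∑ y ∈ B, lam y) * max σ 0 := by positivity
    linarith
  | succ n ih =>
    intro σ hσ
    let _ : MeasurableSpace X := ⊤
    have : Countable X := Finite.to_countable
    have hg : Measurable fun q : (ℝ × ℝ) × X => ageUpdate B q.2 q.1 :=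
      measurable_from_prod_countable_left (measurable_ageUpdate B)
    have hU : Measurable fun q : ℝ × (X × ℕ → ℝ) =>
        ageUpdate B (firstLoc q.2) (q.1, firstGap q.2) :=
      hg.comp ((measurable_fst.prodMk (measurable_firstGap.comp measurable_snd)).prodMk
        (measurable_firstLoc.comp measurable_snd))
    have e1 := lintegral_state lam z (measurable_ageUpdate B) n ((hq σ).comp hU)
    simp only [age, state]
    simp only [Function.comp] at e1
    rw [e1]
    have e2 : ∀ ω : X × ℕ → ℝ, ∫⁻ ω', ∫⁻ t, (Set.Ici σ).indicator (1 : ℝ → ℝ≥0∞)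
        (ageUpdate B (firstLoc ω') (state z (ageUpdate B) n ω, firstGap ω') + t)
          ∂(expMeasure (∑ y, lam y)) ∂(waitingLaw lam) =
        ∑ x, ENNReal.ofReal (lam x / ∑ y, lam y) * ∫⁻ s, ∫⁻ t,
          (Set.Ici σ).indicator (1 : ℝ → ℝ≥0∞) (ageUpdate B x (age B z n ω, s) + t)
            ∂(expMeasure (∑ y, lam y)) ∂(expMeasure (∑ y, lam y)) := fun ω => by
      rw [lintegral_step lam (Φ := fun x q => ∫⁻ t, (Set.Ici σ).indicator (1 : ℝ → ℝ≥0∞)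
        (ageUpdate B x (state z (ageUpdate B) n ω, q.1) + t) ∂(expMeasure (∑ y, lam y)))]
      · simp [age]
      · intro x
        exact (hq σ).comp ((measurable_ageUpdate B x).comp
          (measurable_const.prodMk measurable_fst))
    simp only [e2]
    have hm3 : ∀ x, Measurable fun q : (X × ℕ → ℝ) × ℝ => ∫⁻ t,
        (Set.Ici σ).indicator (1 : ℝ → ℝ≥0∞) (ageUpdate B x (age B z n q.1, q.2) + t)
            ∂(expMeasure (∑ y, lam y)) := fun x =>
      (hq σ).comp ((measurable_ageUpdate B x).comp
          (((hage n).comp measurable_fst).prodMk measurable_snd))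
    rw [lintegral_finsetSum _ fun x _ => (hm3 x).lintegral_prod_right'.const_mul _]
    refine (exp_le_sum_lintegral lam B σ).trans (Finset.sum_le_sum fun x _ => ?_)
    rw [lintegral_const_mul _ (hm3 x).lintegral_prod_right']
    refine mul_le_mul_right ?_ _
    rw [lintegral_lintegral_swap (hm3 x).aemeasurable]
    by_cases hx : x ∈ B
    · simp only [hx, if_true, ageUpdate, zero_add, lintegral_const, measure_univ, mul_one]
      exact le_rfl
    · refine lintegral_mono_ae ?_
      filter_upwards [ae_expMeasure_pos hL] with s hs
      simp only [hx, if_false, ageUpdate]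
      refine (ih (σ - s) (by linarith)).trans (le_of_eq ?_)
      refine lintegral_congr fun ω => lintegral_congr fun t => ?_
      simp only [Set.indicator, Set.mem_Ici]
      congr 1
      rw [sub_le_iff_le_add, add_right_comm]

end Age

-- Sums over matched pairs

section Pairs

variable {X : Type*} {m : ℕ} {σ : Fin m → Request X}

lemma Solution.sum_eq (A : Solution σ) (h : Fin m → ℝ) :
    ∑ i, h i = ∑ i with i < A.partner i, (h i + h (A.partner i)) := by
  rw [← Finset.sum_filter_add_sum_filter_not _ (fun i => i < A.partner i), Finset.sum_add_distrib]
  congr 1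
  refine Finset.sum_nbij' A.partner A.partner ?_ ?_ ?_ ?_ ?_
  · intro i hi
    simp only [Finset.mem_filter, Finset.mem_univ, true_and, not_lt] at hi ⊢
    rw [A.partner_partner]
    exact lt_of_le_of_ne hi (A.partner_ne i)
  · intro i hi
    simp only [Finset.mem_filter, Finset.mem_univ, true_and, not_lt] at hi ⊢
    rw [A.partner_partner]
    exact hi.le
  · intro i _
    exact A.partner_partner i
  · intro i _
    exact A.partner_partner i
  · intro i _
    rw [A.partner_partner]

variable [MetricSpace X]

/-- Each request is charged to the full cost of its pair, so every pair is charged twice. -/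
lemma Solution.sum_le_two_mul_cost (A : Solution σ) {f : ℝ → ℝ} {c : Fin m → ℝ}
    (hc : ∀ i, c i ≤ dist (σ i).loc (σ (A.partner i)).loc + f (A.serve i - (σ i).time) +
      f (A.serve i - (σ (A.partner i)).time)) :
    ∑ i, c i ≤ 2 * A.cost f := by
  refine (Finset.sum_le_sum fun i _ => hc i).trans ?_
  rw [Finset.sum_add_distrib, Finset.sum_add_distrib, Solution.cost, mul_add, two_mul, two_mul]
  have h1 : ∑ i, f (A.serve i - (σ (A.partner i)).time) = ∑ i, f (A.serve i - (σ i).time) := by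
    refine Finset.sum_nbij' A.partner A.partner (by simp) (by simp)
      (fun i _ => A.partner_partner i) (fun i _ => A.partner_partner i) fun i _ => ?_
    rw [A.serve_partner]
  have h2 : ∑ i, dist (σ i).loc (σ (A.partner i)).loc =
      ∑ i with i < A.partner i, dist (σ i).loc (σ (A.partner i)).loc +
        ∑ i with i < A.partner i, dist (σ i).loc (σ (A.partner i)).loc := by
    rw [A.sum_eq, ← Finset.sum_add_distrib]
    refine Finset.sum_congr rfl fun i _ => ?_
    rw [A.partner_partner, dist_comm (σ (A.partner i)).loc]
  rw [h1, h2]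
  linarith

end Pairs

-- Lower bound for the optimum

section LowerBound

variable {X : Type*} [Fintype X] [Nonempty X]

/-- Request `n` is isolated: within time `τ` before and after it there are no other requests in
`B`. -/
def Isolated (B : Finset X) (τ : ℝ) (n : ℕ) (ω : X × ℕ → ℝ) : Prop :=
  τ ≤ age B τ n ω + firstGap (shift^[n] ω) ∧ ∀ y ∈ B, τ < (shift^[n + 1] ω) (y, 0)

lemma Isolated.le_abs_sub {B : Finset X} {τ : ℝ} {n : ℕ} {ω : X × ℕ → ℝ}
    (h : Isolated B τ n ω) (hω : ∀ n p, 0 < (shift^[n] ω) p) {j : ℕ} (hj : j ≠ n)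
    (hB : firstLoc (shift^[j] ω) ∈ B) : τ ≤ |epoch (n + 1) ω - epoch (j + 1) ω| := by
  rcases hj.lt_or_gt with hj | hj
  · refine le_trans ?_ (le_abs_self _)
    have := age_le B τ hω hj hB
    rw [epoch_succ n]
    linarith [h.1]
  · rw [abs_sub_comm]
    refine le_trans ?_ (le_abs_self _)
    have h1 := next_arrival_mono hω (firstLoc (shift^[j] ω)) (Nat.succ_le_of_lt hj)
    have h2 := h.2 _ hB
    rw [epoch_succ j, firstGap]
    simp only [Nat.succ_eq_add_one] at h1
    linarith

variable (lam : X → ℝ) [hlam : Fact (∀ x, 0 < lam x)]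

/-- Past, location and future of the n-th request are independent; the quiet windows before and
after it contribute e^{-λ(B)τ} each. -/
lemma exp_le_lintegral_isolated (B : Finset X) {τ : ℝ} (hτ : 0 ≤ τ) (n : ℕ) (x : X) :
    ENNReal.ofReal (lam x / ∑ y, lam y) *
      ENNReal.ofReal (Real.exp (-(2 * ((∑ y ∈ B, lam y) * τ)))) ≤
      ∫⁻ ω, (open Classical in if firstLoc (shift^[n] ω) = x ∧ Isolated B τ n ω then 1 else 0)
        ∂(waitingLaw lam) := by
  classical
  let _ : MeasurableSpace X := ⊤
  have : Countable X := Finite.to_countable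
  have hI : Measurable ((Set.Ici τ).indicator (1 : ℝ → ℝ≥0∞)) :=
    measurable_one.indicator measurableSet_Ici
  have hS := measurableSet_forall_lt B τ
  set S := {ω : X × ℕ → ℝ | ∀ y ∈ B, τ < ω (y, 0)} with hSdef
  let Φ : ℝ × (X × ℕ → ℝ) → ℝ≥0∞ := fun q =>
    (firstLoc ⁻¹' {x}).indicator 1 q.2 *
      ((Set.Ici τ).indicator 1 (q.1 + firstGap q.2) * S.indicator 1 (shift q.2))
  have hΦ : Measurable Φ := by
    refine (((measurable_one.indicator (measurable_firstLoc (measurableSet_singleton x))).comp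
      measurable_snd)).mul (Measurable.mul ?_ ?_)
    · exact hI.comp (measurable_fst.add (measurable_firstGap.comp measurable_snd))
    · exact (measurable_one.indicator hS).comp (measurable_shift.comp measurable_snd)
  have h1 : ∀ ω, (if firstLoc (shift^[n] ω) = x ∧ Isolated B τ n ω then 1 else 0) =
      Φ (age B τ n ω, shift^[n] ω) := fun ω => by
    simp only [Φ, Isolated, Set.indicator, Set.mem_preimage, Set.mem_singleton_iff, Set.mem_Ici,
      Pi.one_apply, Function.iterate_succ_apply', hSdef, Set.mem_ofPred_eq]
    by_cases h1 : firstLoc (shift^[n] ω) = x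
    · by_cases h2 : τ ≤ age B τ n ω + firstGap (shift^[n] ω)
      · simp [h1, h2]
      · simp [h1, h2]
    · simp [h1]
  simp only [h1]
  have e1 := lintegral_state lam τ (measurable_ageUpdate B) n hΦ
  simp only [age]
  rw [e1]
  have e2 : ∀ ω : X × ℕ → ℝ, ∫⁻ ω', Φ (state τ (ageUpdate B) n ω, ω') ∂(waitingLaw lam) =
      ENNReal.ofReal (lam x / ∑ y, lam y) *
        (ENNReal.ofReal (Real.exp (-((∑ y ∈ B, lam y) * τ))) *
        ∫⁻ t, (Set.Ici τ).indicator 1 (age B τ n ω + t) ∂(expMeasure (∑ y, lam y))) := fun ω => by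
    simp only [Φ]
    have hm : Measurable fun t => (Set.Ici τ).indicator (1 : ℝ → ℝ≥0∞) (state τ (ageUpdate B) n ω + t) :=
      hI.comp (measurable_const.add measurable_id)
    have := lintegral_step lam (Φ := fun z q => (({x} : Set X).indicator 1 z : ℝ≥0∞) *
      ((Set.Ici τ).indicator 1 (state τ (ageUpdate B) n ω + q.1) * S.indicator 1 q.2)) (fun z =>
        ((hm.comp measurable_fst).mul
          ((measurable_one.indicator hS).comp measurable_snd)).const_mul _)
    refine this.trans ?_
    rw [Finset.sum_eq_single x]
    · congr 1
      simp only [Set.indicator_of_mem (Set.mem_singleton x), Pi.one_apply, one_mul]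
      simp_rw [lintegral_const_mul _ (measurable_one.indicator hS), lintegral_indicator_one hS,
        hSdef, waitingLaw_forall_lt lam B hτ]
      rw [lintegral_mul_const _ hm, mul_comm]
      rfl
    · intro z _ hz
      simp [Set.indicator, hz]
    · simp
  simp only [e2]
  have hm2 : Measurable fun ω => ∫⁻ t, (Set.Ici τ).indicator (1 : ℝ → ℝ≥0∞) (age B τ n ω + t)
      ∂(expMeasure (∑ y, lam y)) := by
    have hL := sum_lam_pos lam
    have := isProbabilityMeasure_expMeasure hL
    exact (hI.comp (((measurable_state τ (measurable_ageUpdate B) n).comp measurable_fst).add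
      measurable_snd)).lintegral_prod_right'
        (f := fun q : (X × ℕ → ℝ) × ℝ => (Set.Ici τ).indicator (1 : ℝ → ℝ≥0∞) (age B τ n q.1 + q.2))
  rw [lintegral_const_mul _ (hm2.const_mul _), lintegral_const_mul _ hm2]
  refine mul_le_mul_right ?_ _
  have h3 := exp_le_lintegral_age lam B τ n τ le_rfl
  rw [max_eq_left hτ] at h3
  refine le_trans (le_of_eq ?_) (mul_le_mul_right h3 _)
  rw [← ENNReal.ofReal_mul (Real.exp_nonneg _), ← Real.exp_add]
  congr 2
  ring

variable [MetricSpace X]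

/-- The pair of an isolated request costs at least ρ/2, by distance or by delay; charging pairs
twice leaves ρ/4 per isolated request. -/
lemma ofReal_sum_le_opt {f : ℝ → ℝ} (hf0 : ∀ t, 0 ≤ t → 0 ≤ f t)
    {ρ : X → ℝ≥0∞} (hρt : ∀ x, ρ x ≠ ⊤) {τ : X → ℝ}
    (hτ : ∀ x t, τ x ≤ t → (ρ x).toReal / 2 ≤ f t) {ω : X × ℕ → ℝ}
    (hω : ∀ n p, 0 < (shift^[n] ω) p) (m : ℕ) :
    ∑ i ∈ Finset.range m, (open Classical in
      if Isolated (ballFinset (firstLoc (shift^[i] ω)) (ρ (firstLoc (shift^[i] ω)) / 2))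
        (τ (firstLoc (shift^[i] ω))) i ω then ρ (firstLoc (shift^[i] ω)) / 4 else 0) ≤
      opt f (requests ω m) := by
  classical
  refine le_iInf fun A => ?_
  let x : ℕ → X := fun i => firstLoc (shift^[i] ω)
  let c : Fin m → ℝ := fun i =>
    if Isolated (ballFinset (x i) (ρ (x i) / 2)) (τ (x i)) i ω then (ρ (x i)).toReal / 2 else 0
  have hc0 : ∀ i, 0 ≤ c i := fun i => by
    simp only [c]
    split_ifs <;> positivity
  have hmain := A.sum_le_two_mul_cost (f := f) (c := c) fun i => by
    set j := A.partner i with hj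
    have hi1 := A.time_le_serve i
    have hi2 := A.time_le_serve j
    rw [hj, A.serve_partner, ← hj] at hi2
    have hf1 := hf0 _ (sub_nonneg.2 hi1)
    have hf2 := hf0 _ (sub_nonneg.2 hi2)
    simp only [c]
    split_ifs with hiso
    · by_cases hd : edist (x i) (x j) ≤ ρ (x i) / 2
      · have hne : (j : ℕ) ≠ i := fun h => A.partner_ne i (Fin.ext h)
        have h1 := hiso.le_abs_sub hω hne (mem_ballFinset.2 hd)
        rw [← requests_time ω m i, ← requests_time ω m j] at h1
        have hd0 : 0 ≤ dist (requests ω m i).loc (requests ω m j).loc := dist_nonneg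
        -- The arrivals are at least τ apart, so the earlier of the two requests waits at least τ
        -- for the later one.
        rcases le_abs'.1 h1 with h | h
        · have := hτ (x i) (A.serve i - (requests ω m i).time) (by linarith)
          linarith
        · have := hτ (x i) (A.serve i - (requests ω m j).time) (by linarith)
          linarith
      · have h1 : (ρ (x i)).toReal / 2 ≤ dist (x i) (x j) := by
          rw [edist_dist, not_le, ENNReal.lt_ofReal_iff_toReal_lt
            (ENNReal.div_ne_top (hρt _) (by norm_num))] at hd
          simpa using hd.le
        rw [requests_loc, requests_loc]
        simp only [x] at h1
        linarith
    · have : 0 ≤ dist (requests ω m i).loc (requests ω m j).loc := dist_nonneg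
      linarith
  have hsum : ∑ i ∈ Finset.range m, (if Isolated (ballFinset (x i) (ρ (x i) / 2))
      (τ (x i)) i ω then ρ (x i) / 4 else 0) = ENNReal.ofReal (∑ i, c i / 2) := by
    rw [ENNReal.ofReal_sum_of_nonneg fun i _ => div_nonneg (hc0 i) (by norm_num),
      Finset.sum_range]
    refine Finset.sum_congr rfl fun i _ => ?_
    simp only [c]
    split_ifs
    · rw [div_div, ENNReal.ofReal_div_of_pos (by norm_num), ENNReal.ofReal_toReal (hρt _)]
      norm_num
    · simp
  refine hsum.le.trans (ENNReal.ofReal_le_ofReal ?_)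
  rw [← Finset.sum_div]
  linarith

/-- The expected radius of the location of a request. -/
def meanRadius (f : ℝ → ℝ) : ℝ≥0∞ :=
  ∑ x, ENNReal.ofReal (lam x / ∑ y, lam y) * radius f lam x

lemma le_expected_opt {α : ℝ} (hα : 0 ≤ α) (m : ℕ) :
    m * (ENNReal.ofReal (Real.exp (-(2 * (1 + α)))) / 4 * meanRadius lam fun t => t ^ α) ≤
      expected lam m (opt fun t => t ^ α) := by
  classical
  set f : ℝ → ℝ := fun t => t ^ α with hf
  let ρ : X → ℝ≥0∞ := radius f lam
  choose τ hτ0 hτ hτb using exists_window lam hα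
  let F : ℕ → X → (X × ℕ → ℝ) → ℝ≥0∞ := fun i x ω =>
    if firstLoc (shift^[i] ω) = x ∧ Isolated (ballFinset x (ρ x / 2)) (τ x) i ω then 1 else 0
  have hF : ∀ i x, Measurable (F i x) := by
    intro i x
    let _ : MeasurableSpace X := ⊤
    refine Measurable.ite ?_ measurable_const measurable_const
    refine MeasurableSet.inter ?_ (MeasurableSet.inter ?_ ?_)
    · exact (measurable_firstLoc.comp (measurable_shift_iterate i)) (measurableSet_singleton x)
    · exact measurableSet_le measurable_const ((measurable_state _ (measurable_ageUpdate _) i).add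
        (measurable_firstGap.comp (measurable_shift_iterate i)))
    · exact (measurable_shift_iterate (i + 1)) (measurableSet_forall_lt _ _)
  have h1 : ∫⁻ ω, ∑ i ∈ Finset.range m, ∑ x, F i x ω * (ρ x / 4) ∂(waitingLaw lam) ≤
      expected lam m (opt f) := by
    refine lintegral_mono_ae ?_
    filter_upwards [ae_shift_pos lam] with ω hω
    refine le_trans (le_of_eq ?_) (ofReal_sum_le_opt (f := f)
      (fun t ht => Real.rpow_nonneg ht α) (radius_ne_top lam hα) hτ hω m)
    refine Finset.sum_congr rfl fun i _ => ?_
    rw [Finset.sum_eq_single (firstLoc (shift^[i] ω))]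
    · simp only [F, true_and, ite_mul, one_mul, zero_mul]
      rfl
    · intro x _ hx
      simp [F, Ne.symm hx]
    · simp
  refine le_trans ?_ h1
  rw [lintegral_finsetSum _ fun i _ => Finset.measurable_sum _ fun x _ => (hF i x).mul_const _]
  have h2 : ∀ i, ENNReal.ofReal (Real.exp (-(2 * (1 + α)))) / 4 * meanRadius lam f ≤
      ∫⁻ ω, ∑ x, F i x ω * (ρ x / 4) ∂(waitingLaw lam) := fun i => by
    rw [lintegral_finsetSum _ fun x _ => (hF i x).mul_const _, meanRadius, Finset.mul_sum]
    refine Finset.sum_le_sum fun x _ => ?_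
    rw [lintegral_mul_const _ (hF i x)]
    refine le_trans ?_ (mul_le_mul_left
      (exp_le_lintegral_isolated lam (ballFinset x (ρ x / 2)) (hτ0 x) i x) _)
    have h3 : ENNReal.ofReal (Real.exp (-(2 * (1 + α)))) ≤ ENNReal.ofReal
        (Real.exp (-(2 * ((∑ y ∈ ballFinset x (ρ x / 2), lam y) * τ x)))) := by
      refine ENNReal.ofReal_le_ofReal (Real.exp_le_exp.2 ?_)
      have := hτb x
      rw [ballRate_eq] at this
      simp only [ρ]
      linarith
    calc _ = ENNReal.ofReal (lam x / ∑ y, lam y) * ENNReal.ofReal (Real.exp (-(2 * (1 + α)))) *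
          (ρ x / 4) := by
          simp only [div_eq_mul_inv, ρ]
          ring
      _ ≤ _ := by gcongr
  calc _ = ∑ i ∈ Finset.range m,
        ENNReal.ofReal (Real.exp (-(2 * (1 + α)))) / 4 * meanRadius lam f := by simp
    _ ≤ _ := Finset.sum_le_sum fun i _ => h2 i

lemma meanRadius_pos {α : ℝ} (hα : 0 ≤ α) : 0 < meanRadius lam fun t => t ^ α := by
  have hL := sum_lam_pos lam
  refine lt_of_lt_of_le ?_ (Finset.single_le_sum (fun _ _ => zero_le)
    (Finset.mem_univ (Classical.arbitrary X)))
  exact ENNReal.mul_pos (ENNReal.ofReal_pos.2 (div_pos (hlam.out _) hL)).ne'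
    (radius_pos lam hα _).ne'

end LowerBound

-- Greedy matchings and parity

section Matching

/-- Remove a cheapest pair and recurse: whichever of i and j is removed first is matched at cost at
most c i j. Greedy uses it with critical times as costs; for Radius, with c = 0, it merely pairs up
the leftovers. -/
lemma exists_greedy_matching {ι : Type*} (c : ι → ι → ℝ) (hc : ∀ i j, c i j = c j i)
    (U : Finset ι) (hU : Even U.card) :
    ∃ p : ι → ι, (∀ i ∈ U, p i ∈ U ∧ p (p i) = i ∧ p i ≠ i) ∧
      ∀ i ∈ U, ∀ j ∈ U, i ≠ j → min (c i (p i)) (c j (p j)) ≤ c i j := by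
  classical
  induction U using Finset.strongInduction with
  | H U ih =>
    rcases U.eq_empty_or_nonempty with rfl | hne
    · exact ⟨id, by simp, by simp⟩
    have h2 : 1 < U.card := by
      have := hne.card_pos
      rcases hU with ⟨r, hr⟩
      omega
    obtain ⟨q, hq, hmin⟩ := Finset.exists_min_image U.offDiag (fun q => c q.1 q.2)
      (by
        obtain ⟨a, ha, b, hb, hab⟩ := Finset.one_lt_card.1 h2
        exact ⟨(a, b), Finset.mem_offDiag.2 ⟨ha, hb, hab⟩⟩)
    obtain ⟨a, b⟩ := q
    obtain ⟨ha, hb, hab⟩ := Finset.mem_offDiag.1 hq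
    simp only at ha hb hab hmin
    obtain ⟨p, hp, hpm⟩ := ih ((U.erase a).erase b)
      ((Finset.erase_ssubset (Finset.mem_erase.2 ⟨hab.symm, hb⟩)).trans (Finset.erase_ssubset ha))
      (by
        rw [Finset.card_erase_of_mem (Finset.mem_erase.2 ⟨hab.symm, hb⟩),
          Finset.card_erase_of_mem ha]
        rcases hU with ⟨r, hr⟩
        exact ⟨r - 1, by omega⟩)
    have hmem : ∀ i, i ∈ (U.erase a).erase b ↔ i ≠ b ∧ i ≠ a ∧ i ∈ U := fun i => by simp
    let p' : ι → ι := fun i => if i = a then b else if i = b then a else p i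
    have hpa : p' a = b := by simp [p']
    have hpb : p' b = a := by simp [p', hab.symm]
    have hpo : ∀ i, i ≠ b → i ≠ a → p' i = p i := fun i h h' => by simp [p', h, h']
    refine ⟨p', fun i hi => ?_, fun i hi j hj hij => ?_⟩
    · by_cases hia : i = a
      · subst hia
        rw [hpa, hpb]
        exact ⟨hb, rfl, hab.symm⟩
      by_cases hib : i = b
      · subst hib
        rw [hpb, hpa]
        exact ⟨ha, rfl, hab⟩
      have h := hp i ((hmem i).2 ⟨hib, hia, hi⟩)
      obtain ⟨h3, h4, h5⟩ := (hmem _).1 h.1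
      rw [hpo i hib hia, hpo _ h3 h4]
      exact ⟨h5, h.2⟩
    · have hm := hmin (i, j) (Finset.mem_offDiag.2 ⟨hi, hj, hij⟩)
      simp only at hm
      by_cases hia : i = a
      · exact (min_le_left _ _).trans (by rw [hia, hpa]; rwa [hia] at hm)
      by_cases hib : i = b
      · exact (min_le_left _ _).trans (by rw [hib, hpb, hc]; rwa [hib] at hm)
      by_cases hja : j = a
      · exact (min_le_right _ _).trans (by rw [hja, hpa]; rwa [hja] at hm)
      by_cases hjb : j = b
      · exact (min_le_right _ _).trans (by rw [hjb, hpb, hc]; rwa [hjb] at hm)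
      rw [hpo i hib hia, hpo j hjb hja]
      exact hpm i ((hmem i).2 ⟨hib, hia, hi⟩) j ((hmem j).2 ⟨hjb, hja, hj⟩) hij

lemma even_card_fixedPoints {k : ℕ} {p : Fin (2 * k) → Fin (2 * k)} (hp : ∀ i, p (p i) = i) :
    Even (Finset.univ.filter fun i => p i = i).card := by
  have h : ((Finset.univ.filter fun i => ¬ p i = i).card : ZMod 2) = 0 := by
    rw [Finset.card_eq_sum_ones, Nat.cast_sum]
    refine Finset.sum_involution (fun i _ => p i) ?_ ?_ ?_ ?_
    · intros
      decide
    · intro i hi _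
      exact (Finset.mem_filter.1 hi).2
    · intro i hi
      have := (Finset.mem_filter.1 hi).2
      refine Finset.mem_filter.2 ⟨Finset.mem_univ _, fun h => this ?_⟩
      rw [hp] at h
      exact h.symm
    · intro i _
      exact hp i
  rw [ZMod.natCast_eq_zero_iff_even] at h
  have h2 := Finset.card_filter_add_card_filter_not (s := Finset.univ) (fun i => p i = i)
  rw [Finset.card_univ, Fintype.card_fin] at h2
  rcases h with ⟨r, hr⟩
  exact ⟨k - r, by omega⟩

end Matching

-- Existence of an output of Radius

section RadiusExists

variable {X : Type*} [MetricSpace X] {m : ℕ} (ρ : X → ℝ≥0∞) (σ : Fin m → Request X)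

/-- Request `j` is pending when `i` is processed, for the partial matching `p` whose fixed points
are the unmatched requests. -/
def PartialPending (p : Fin m → Fin m) (i j : Fin m) : Prop := j < i ∧ (p j = j ∨ i ≤ p j)

/-- The rules of Radius for the processing of `i`, for the partial matching `p`. -/
def PartialRules (p : Fin m → Fin m) (i : Fin m) : Prop :=
  let near : Fin m → Prop := fun j =>
    PartialPending p i j ∧ edist (σ i).loc (σ j).loc ≤ ρ (σ j).loc
  let overlap : Fin m → Prop := fun j =>
    PartialPending p i j ∧ edist (σ i).loc (σ j).loc ≤ ρ (σ j).loc + ρ (σ i).loc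
  ((∃ j, near j) → near (p i)) ∧
  ((¬ ∃ j, near j) → (∃ j, overlap j) → overlap (p i)) ∧
  ((¬ ∃ j, near j) → (¬ ∃ j, overlap j) → p i = i ∨ i < p i)

/-- Run the algorithm on the first n requests. Existence matters because `worstCost` is infinite
when there is no output. -/
lemma exists_partial_radius (n : ℕ) : ∃ p : Fin m → Fin m, (∀ i, p (p i) = i) ∧
    (∀ i, n ≤ i.val → p i = i) ∧ ∀ i, i.val < n → PartialRules ρ σ p i := by
  classical
  induction n with
  | zero => exact ⟨id, by simp, by simp, by simp⟩
  | succ n ih =>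
    obtain ⟨p, hpp, hpn, hpr⟩ := ih
    by_cases hn : n < m
    swap
    · exact ⟨p, hpp, fun i _ => hpn i (by omega), fun i _ => hpr i (by omega)⟩
    set i₀ : Fin m := ⟨n, hn⟩ with hi₀
    have hfix0 : p i₀ = i₀ := hpn i₀ le_rfl
    let near : Fin m → Prop := fun j =>
      PartialPending p i₀ j ∧ edist (σ i₀).loc (σ j).loc ≤ ρ (σ j).loc
    let overlap : Fin m → Prop := fun j =>
      PartialPending p i₀ j ∧ edist (σ i₀).loc (σ j).loc ≤ ρ (σ j).loc + ρ (σ i₀).loc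
    have hno : ∀ j, near j → overlap j := fun j h => ⟨h.1, h.2.trans le_self_add⟩
    by_cases hex : ∃ j, overlap j
    swap
    · refine ⟨p, hpp, fun i hi => hpn i (by omega), fun i hi => ?_⟩
      rcases Nat.lt_succ_iff_lt_or_eq.1 hi with hi | hi
      · exact hpr i hi
      · have : i = i₀ := Fin.ext hi
        subst this
        exact ⟨fun ⟨j, hj⟩ => (hex ⟨j, hno j hj⟩).elim, fun _ h => (hex h).elim,
          fun _ _ => Or.inl hfix0⟩
    obtain ⟨j, hj, hjn⟩ : ∃ j, overlap j ∧ ((∃ j, near j) → near j) := by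
      by_cases h : ∃ j, near j
      · obtain ⟨j, hj⟩ := h
        exact ⟨j, hno j hj, fun _ => hj⟩
      · obtain ⟨j, hj⟩ := hex
        exact ⟨j, hj, fun h' => (h h').elim⟩
    have hjlt : j < i₀ := hj.1.1
    have hfixj : p j = j := by
      rcases hj.1.2 with h | h
      · exact h
      · have h2 := hpn (p j) h
        rw [hpp] at h2
        exact h2.symm
    let p' : Fin m → Fin m := fun i => if i = i₀ then j else if i = j then i₀ else p i
    have hp0 : p' i₀ = j := by simp [p']
    have hpj : p' j = i₀ := by simp [p', hjlt.ne]
    have hpo : ∀ i, i ≠ i₀ → i ≠ j → p' i = p i := fun i h h' => by simp [p', h, h']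
    -- A request matched with i₀ still counts as pending for every i ≤ i₀, so the rules for earlier
    -- requests see no change.
    have hpend : ∀ i, i ≤ i₀ → ∀ l, PartialPending p' i l ↔ PartialPending p i l := by
      intro i hi l
      refine and_congr_right fun hl => ?_
      by_cases hlj : l = j
      · subst hlj
        rw [hpj, hfixj]
        exact ⟨fun _ => Or.inl rfl, fun _ => Or.inr hi⟩
      · rw [hpo l (hl.trans_le hi).ne hlj]
    refine ⟨p', fun i => ?_, fun i hi => ?_, fun i hi => ?_⟩
    · by_cases h0 : i = i₀
      · rw [h0, hp0, hpj]
      by_cases h1 : i = j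
      · rw [h1, hpj, hp0]
      rw [hpo i h0 h1, hpo, hpp]
      · intro h
        have := hpp i
        rw [h, hfix0] at this
        exact h0 this.symm
      · intro h
        have := hpp i
        rw [h, hfixj] at this
        exact h1 this.symm
    · have h0 : i ≠ i₀ := fun h => by rw [h] at hi; simp [hi₀] at hi
      have h1 : i ≠ j := fun h => by
        rw [h] at hi
        have : j.val < n := hjlt
        omega
      rw [hpo i h0 h1]
      exact hpn i (by omega)
    · have hile : i ≤ i₀ := Nat.lt_succ_iff.1 hi
      simp only [PartialRules, hpend i hile]
      by_cases h0 : i = i₀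
      · rw [h0, hp0]
        exact ⟨hjn, fun _ _ => hj, fun _ h => (h ⟨j, hj⟩).elim⟩
      have hin : i.val < n := lt_of_le_of_ne (Nat.lt_succ_iff.1 hi) fun h => h0 (Fin.ext h)
      have hr := hpr i hin
      -- Request j was a fixed point of p, so only its third rule could apply; that rule also
      -- permits a later partner.
      by_cases h1 : i = j
      · rw [h1] at hr ⊢
        rw [hpj]
        simp only [PartialRules, hfixj] at hr
        exact ⟨fun h => (lt_irrefl _ (hr.1 h).1.1).elim,
          fun h h' => (lt_irrefl _ (hr.2.1 h h').1.1).elim, fun _ _ => Or.inr hjlt⟩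
      · rw [hpo i h0 h1]
        exact hr

lemma exists_isRadius {k : ℕ} (σ : Fin (2 * k) → Request X) : ∃ A : Solution σ, IsRadius ρ A := by
  classical
  obtain ⟨p, hpp, -, hpr⟩ := exists_partial_radius ρ σ (2 * k)
  let U : Finset (Fin (2 * k)) := {i | p i = i}
  have hU : ∀ i, i ∈ U ↔ p i = i := by simp [U]
  obtain ⟨q, hq, -⟩ := exists_greedy_matching (fun _ _ => 0) (fun _ _ => rfl) U
    (even_card_fixedPoints hpp)
  obtain ⟨T, hT⟩ : ∃ T, ∀ i : Fin (2 * k), IsGreatest (Set.range fun j => (σ j).time) T := by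
    rcases isEmpty_or_nonempty (Fin (2 * k)) with h | h
    · exact ⟨0, fun i => (h.false i).elim⟩
    · obtain ⟨j, hj⟩ := Finite.exists_max fun j => (σ j).time
      exact ⟨_, fun _ => ⟨⟨j, rfl⟩, by rintro _ ⟨l, rfl⟩; exact hj l⟩⟩
  let r : Fin (2 * k) → Fin (2 * k) := fun i => if p i = i then q i else p i
  have hrU : ∀ i, p i = i → r i = q i := fun i h => by simp [r, h]
  have hrV : ∀ i, p i ≠ i → r i = p i := fun i h => by simp [r, h]
  have hV : ∀ i, p i ≠ i → p (p i) ≠ p i := fun i h h' => h (by rwa [hpp, eq_comm] at h')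
  have hrr : ∀ i, r (r i) = i := by
    intro i
    by_cases h : p i = i
    · have h2 := hq i ((hU i).2 h)
      rw [hrU i h, hrU _ ((hU _).1 h2.1), h2.2.1]
    · rw [hrV i h, hrV _ (hV i h), hpp]
  have hrfix : ∀ i, p (r i) = r i ↔ p i = i := by
    intro i
    by_cases h : p i = i
    · have h2 := hq i ((hU i).2 h)
      rw [hrU i h]
      exact iff_of_true ((hU _).1 h2.1) h
    · rw [hrV i h]
      exact iff_of_false (hV i h) h
  let A : Solution σ :=
    { partner := r
      partner_partner := hrr
      partner_ne := fun i => by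
        by_cases h : p i = i
        · rw [hrU i h]
          exact (hq i ((hU i).2 h)).2.2
        · rwa [hrV i h]
      serve := fun i => if p i = i then T else max (σ i).time (σ (r i)).time
      serve_partner := fun i => by
        by_cases h : p i = i
        · rw [if_pos h, if_pos ((hrfix i).2 h)]
        · rw [if_neg h, if_neg (fun h' => h ((hrfix i).1 h')), hrr, max_comm]
      time_le_serve := fun i => by
        split_ifs with h
        · exact (hT i).2 ⟨i, rfl⟩
        · exact le_max_left _ _ }
  refine ⟨A, {i | p i = i}, fun i => (hrfix i).symm, fun i hi => ?_, fun i hi => ?_, fun i => ?_⟩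
  · change IsGreatest _ (if p i = i then T else _)
    rw [if_pos (show p i = i from hi)]
    exact hT i
  · exact if_neg hi
  · have hpend : ∀ j, RadiusPending A {i | p i = i} i j ↔ PartialPending p i j := by
      intro j
      refine and_congr_right fun _ => ?_
      by_cases h : p j = j
      · exact iff_of_true (Or.inl h) (Or.inl h)
      · have h2 : A.partner j = p j := hrV j h
        rw [h2]
        rfl
    have hr := hpr i i.2
    simp only [hpend]
    simp only [PartialRules] at hr
    refine ⟨fun h => ?_, fun h h' => ?_, fun h h' => ?_⟩
    · have h1 := hr.1 h
      have h2 : p i ≠ i := h1.1.1.ne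
      rw [show A.partner i = p i from hrV i h2]
      exact ⟨h2, h1⟩
    · have h1 := hr.2.1 h h'
      have h2 : p i ≠ i := h1.1.1.ne
      rw [show A.partner i = p i from hrV i h2]
      exact ⟨h2, h1⟩
    · by_cases h2 : p i = i
      · exact Or.inl h2
      · rw [show A.partner i = p i from hrV i h2]
        exact Or.inr ((hr.2.2 h h').resolve_left h2)

end RadiusExists

-- Waiting for the ball, and averaging over requests

section Upper

variable {X : Type*} [Fintype X] [MetricSpace X] (lam : X → ℝ)

/-- The delay cost of waiting for the next arrival in the ball of `x`. -/
def waitCost (f : ℝ → ℝ) (x : X) (ω : X × ℕ → ℝ) : ℝ≥0∞ :=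
  ENNReal.ofReal (f (minWait (ballFinset x (radius f lam x)) (ballFinset_nonempty x _) ω))

lemma measurable_waitCost {f : ℝ → ℝ} (hf : Measurable f) (x : X) :
    Measurable (waitCost lam f x) :=
  (hf.comp (measurable_minWait _ _)).ennreal_ofReal

variable [hlam : Fact (∀ x, 0 < lam x)]

lemma lintegral_waitCost_le {f : ℝ → ℝ} (hf : Measurable f) (x : X) :
    ∫⁻ ω, waitCost lam f x ω ∂(waitingLaw lam) ≤ radius f lam x := by
  refine le_trans (le_of_eq ?_) (lintegral_le_radius lam f x)
  simp only [waitCost]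
  rw [ballRate_eq, ← map_minWait lam _ (ballFinset_nonempty x _),
    lintegral_map hf.ennreal_ofReal (measurable_minWait _ _)]

variable [Nonempty X]

/-- By stationarity every request contributes the same mean, and the future after its arrival is
independent of its location. -/
lemma lintegral_sum_le {f : ℝ → ℝ} {Ψ : X → (X × ℕ → ℝ) → ℝ≥0∞} (hΨ : ∀ x, Measurable (Ψ x))
    {c : ℝ≥0∞} (hc : ∀ x, ∫⁻ ω, Ψ x ω ∂(waitingLaw lam) ≤ c * radius f lam x) (m : ℕ) :
    ∫⁻ ω, ∑ i ∈ Finset.range m, Ψ (firstLoc (shift^[i] ω)) (shift^[i + 1] ω) ∂(waitingLaw lam) ≤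
      m * (c * meanRadius lam f) := by
  let _ : MeasurableSpace X := ⊤
  have : Countable X := Finite.to_countable
  have hL := sum_lam_pos lam
  have := isProbabilityMeasure_expMeasure hL
  have hm : Measurable fun ω => Ψ (firstLoc ω) (shift ω) := by
    have h : Measurable fun q : (X × ℕ → ℝ) × X => Ψ q.2 q.1 :=
      measurable_from_prod_countable_left hΨ
    exact h.comp (measurable_shift.prodMk measurable_firstLoc)
  simp only [Function.iterate_succ_apply']
  rw [lintegral_finsetSum (f := fun i ω => Ψ (firstLoc (shift^[i] ω)) (shift (shift^[i] ω))) _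
    fun i _ => hm.comp (measurable_shift_iterate i)]
  have h1 : ∀ i ∈ Finset.range m, ∫⁻ ω, Ψ (firstLoc (shift^[i] ω)) (shift (shift^[i] ω))
      ∂(waitingLaw lam) ≤ c * meanRadius lam f := fun i _ => by
    rw [lintegral_iterate_shift lam i hm,
      lintegral_step lam (Φ := fun x q => Ψ x q.2) fun x => (hΨ x).comp measurable_snd,
      meanRadius, Finset.mul_sum]
    refine Finset.sum_le_sum fun x _ => ?_
    simp only [lintegral_const, measure_univ, mul_one]
    rw [mul_left_comm c]
    exact mul_le_mul_right (hc x) _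
  refine (Finset.sum_le_sum h1).trans ?_
  simp

end Upper

-- Upper bound for Radius

section RadiusUpper

variable {X : Type*} [MetricSpace X] {m : ℕ} {σ : Fin m → Request X} {ρ : X → ℝ≥0∞}

/-- The rules of Radius for the set `L` of left over requests. -/
structure IsRadiusWith (ρ : X → ℝ≥0∞) (A : Solution σ) (L : Set (Fin m)) : Prop where
  mem_iff : ∀ i, i ∈ L ↔ A.partner i ∈ L
  serve_left : ∀ i ∈ L, IsGreatest (Set.range fun j => (σ j).time) (A.serve i)
  serve_eq : ∀ i, i ∉ L → A.serve i = max (σ i).time (σ (A.partner i)).time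
  near : ∀ i j, RadiusPending A L i j → edist (σ i).loc (σ j).loc ≤ ρ (σ j).loc →
    i ∉ L ∧ RadiusPending A L i (A.partner i) ∧
      edist (σ i).loc (σ (A.partner i)).loc ≤ ρ (σ (A.partner i)).loc
  overlap : ∀ i j, RadiusPending A L i j → edist (σ i).loc (σ j).loc ≤ ρ (σ j).loc + ρ (σ i).loc →
    i ∉ L ∧ RadiusPending A L i (A.partner i)
  matched : ∀ i, i ∉ L → A.partner i < i →
    edist (σ i).loc (σ (A.partner i)).loc ≤ ρ (σ (A.partner i)).loc + ρ (σ i).loc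

lemma IsRadius.exists_left {A : Solution σ} (h : IsRadius ρ A) : ∃ L, IsRadiusWith ρ A L := by
  obtain ⟨L, h1, h2, h3, h4⟩ := h
  refine ⟨L, h1, h2, h3, fun i j hp hd => ?_, fun i j hp hd => ?_, fun i hi hlt => ?_⟩
  · exact (h4 i).1 ⟨j, hp, hd⟩
  · by_cases hn : ∃ j, RadiusPending A L i j ∧ edist (σ i).loc (σ j).loc ≤ ρ (σ j).loc
    · have := (h4 i).1 hn
      exact ⟨this.1, this.2.1⟩
    · have := (h4 i).2.1 hn ⟨j, hp, hd⟩
      exact ⟨this.1, this.2.1⟩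
  · by_cases hn : ∃ j, RadiusPending A L i j ∧ edist (σ i).loc (σ j).loc ≤ ρ (σ j).loc
    · exact ((h4 i).1 hn).2.2.trans le_self_add
    · by_cases ho : ∃ j, RadiusPending A L i j ∧
          edist (σ i).loc (σ j).loc ≤ ρ (σ j).loc + ρ (σ i).loc
      · exact ((h4 i).2.1 hn ho).2.2
      · rcases (h4 i).2.2 hn ho with h | h
        · exact (hi h).elim
        · exact (lt_asymm h hlt).elim

variable {A : Solution σ} {L : Set (Fin m)}

/-- Otherwise the overlap rule would have matched j on arrival. Hence the balls of simultaneously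
pending requests are disjoint. -/
lemma IsRadiusWith.far (h : IsRadiusWith ρ A L) {i j : Fin m} (hij : i < j)
    (hi : i ∈ L ∨ j ≤ A.partner i) (hj : j ∈ L ∨ j < A.partner j) :
    ρ (σ i).loc + ρ (σ j).loc < edist (σ i).loc (σ j).loc := by
  by_contra! hd
  rw [edist_comm] at hd
  obtain ⟨h1, h2⟩ := h.overlap j i ⟨hij, hi⟩ hd
  rcases hj with hj | hj
  · exact h1 hj
  · exact lt_asymm hj h2.1

lemma IsRadiusWith.eq_of_loc_eq (h : IsRadiusWith ρ A L) {i j : Fin m} (hi : i ∈ L) (hj : j ∈ L)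
    (hij : (σ i).loc = (σ j).loc) : i = j := by
  rcases lt_trichotomy i j with hlt | heq | hlt
  · have := h.far hlt (Or.inl hi) (Or.inl hj)
    simp [hij] at this
  · exact heq
  · have := h.far hlt (Or.inl hj) (Or.inl hi)
    simp [hij] at this

/-- An arrival k in the ball of a pending i is matched with some pending j whose ball contains k. If
j ≠ i, two pending requests would have k in both balls, against `IsRadiusWith.far`. This is why the
near rule has priority over the overlap rule. -/
lemma IsRadiusWith.partner_le (h : IsRadiusWith ρ A L) {i k : Fin m} (hik : i < k)
    (hi : i ∈ L ∨ i < A.partner i) (hd : edist (σ i).loc (σ k).loc ≤ ρ (σ i).loc) :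
    i ∉ L ∧ A.partner i ≤ k := by
  by_contra hcon
  have hi' : i ∈ L ∨ k < A.partner i := by
    by_contra! h'
    exact hcon h'
  obtain ⟨hk, hp, hd'⟩ := h.near k i ⟨hik, hi'.imp_right le_of_lt⟩ (by rwa [edist_comm])
  set j := A.partner k with hj
  have hjk : A.partner j = k := A.partner_partner k
  have hne : j ≠ i := by
    intro hji
    rw [hji] at hjk
    rcases hi' with h' | h'
    · exact hk (hjk ▸ (h.mem_iff i).1 h')
    · exact h'.ne hjk.symm
  have htri : edist (σ i).loc (σ j).loc ≤ ρ (σ i).loc + ρ (σ j).loc :=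
    (edist_triangle _ (σ k).loc _).trans (add_le_add hd hd')
  rcases hne.lt_or_gt with hlt | hlt
  · have := h.far hlt (Or.inr (by rw [hjk]; exact hik.le)) hi
    rw [edist_comm, add_comm] at this
    exact absurd htri (not_le.2 this)
  · have := h.far hlt (hi'.imp_right fun h' => (hp.1.trans h').le)
      (Or.inr (by rw [hjk]; exact hp.1))
    exact absurd htri (not_le.2 this)

lemma IsRadiusWith.connection_le [Fintype X] (h : IsRadiusWith ρ A L) (hρ : ∀ x, ρ x ≠ ⊤) {D : ℝ}
    (hD : ∀ x y : X, dist x y ≤ D) (hD0 : 0 ≤ D) :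
    ∑ i with i < A.partner i, dist (σ i).loc (σ (A.partner i)).loc ≤
      ∑ i, (ρ (σ i).loc).toReal + Fintype.card X * D := by
  classical
  have h1 : ∀ i, i < A.partner i → dist (σ i).loc (σ (A.partner i)).loc ≤
      ((ρ (σ i).loc).toReal + (ρ (σ (A.partner i)).loc).toReal) + if i ∈ L then D else 0 := by
    intro i hi
    have h0 : 0 ≤ (ρ (σ i).loc).toReal + (ρ (σ (A.partner i)).loc).toReal := by positivity
    split_ifs with hL
    · linarith [hD (σ i).loc (σ (A.partner i)).loc]
    · have h2 := h.matched (A.partner i) (fun h' => hL ((h.mem_iff i).2 h'))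
        (by rwa [A.partner_partner])
      rw [A.partner_partner, edist_comm] at h2
      rw [add_zero, ← ENNReal.toReal_add (hρ _) (hρ _), dist_edist]
      exact ENNReal.toReal_mono (ENNReal.add_ne_top.2 ⟨hρ _, hρ _⟩) h2
  have h2 : (Finset.univ.filter fun i => i ∈ L).card ≤ Fintype.card X := by
    refine Finset.card_le_card_of_injOn (fun i => (σ i).loc) (by simp) ?_
    intro i hi j hj hij
    simp only [Finset.coe_filter, Finset.mem_univ, true_and, Set.mem_ofPred_eq] at hi hj
    exact h.eq_of_loc_eq hi hj hij
  calc _ ≤ ∑ i with i < A.partner i, (((ρ (σ i).loc).toReal + (ρ (σ (A.partner i)).loc).toReal) +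
        if i ∈ L then D else 0) :=
        Finset.sum_le_sum fun i hi => h1 i (Finset.mem_filter.1 hi).2
    _ ≤ ∑ i, (ρ (σ i).loc).toReal + ∑ i, (if i ∈ L then D else 0) := by
        rw [Finset.sum_add_distrib, ← A.sum_eq fun i => (ρ (σ i).loc).toReal]
        refine add_le_add le_rfl (Finset.sum_le_sum_of_subset_of_nonneg (Finset.filter_subset _ _)
          fun i _ _ => ?_)
        split_ifs <;> simp [hD0]
    _ ≤ _ := by
        gcongr
        rw [← Finset.sum_filter, Finset.sum_const, nsmul_eq_mul]
        gcongr

variable [Fintype X] [Nonempty X]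

/-- Either i is matched on its own arrival, or the next arrival at y ends its wait by
`IsRadiusWith.partner_le`, or the sequence ends earlier and the leftovers are served at that moment.
-/
lemma IsRadiusWith.serve_le {ω : X × ℕ → ℝ} (hω : ∀ n p, 0 < (shift^[n] ω) p)
    {A : Solution (requests ω m)} {L : Set (Fin m)} (h : IsRadiusWith ρ A L) (i : Fin m) (y : X)
    (hy : edist (firstLoc (shift^[i] ω)) y ≤ ρ (firstLoc (shift^[i] ω))) :
    A.serve i ≤ (requests ω m i).time + (shift^[i + 1] ω) (y, 0) := by
  have hmono := (epoch_strictMono hω).monotone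
  have hw := hω (i + 1) (y, 0)
  by_cases hp : i ∈ L ∨ i < A.partner i
  swap
  · push Not at hp
    rw [h.serve_eq i hp.1]
    have h1 : (requests ω m (A.partner i)).time ≤ (requests ω m i).time := by
      rw [requests_time, requests_time]
      exact hmono (Nat.succ_le_succ hp.2)
    rw [max_eq_left h1]
    linarith
  rcases exists_next_arrival hω y (Nat.succ_le_of_lt i.2) with ⟨k, h1, h2, h3, h4⟩ | hlast
  · have hik : i < (⟨k, h2⟩ : Fin m) := h1
    obtain ⟨hL, hk⟩ := h.partner_le hik hp (by rw [requests_loc, requests_loc]; simpa [h3] using hy)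
    rw [h.serve_eq i hL]
    have h5 : (requests ω m i).time + (shift^[i + 1] ω) (y, 0) =
        (requests ω m ⟨k, h2⟩).time := by
      rw [requests_time, requests_time]
      exact h4.symm
    rw [h5]
    refine max_le ?_ ?_
    · rw [requests_time, requests_time]
      exact hmono (Nat.succ_le_succ hik.le)
    · rw [requests_time, requests_time]
      exact hmono (Nat.succ_le_succ hk)
  · have h5 : ∀ j, (requests ω m j).time ≤ epoch m ω := fun j => by
      rw [requests_time]
      exact hmono j.2
    have h6 : A.serve i ≤ epoch m ω := by
      by_cases hL : i ∈ L
      · obtain ⟨j, hj⟩ := (h.serve_left i hL).1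
        rw [← hj]
        exact h5 j
      · rw [h.serve_eq i hL]
        exact max_le (h5 _) (h5 _)
    rw [requests_time]
    exact h6.trans hlast.le

lemma radiusCost_le (lam : X → ℝ) {f : ℝ → ℝ} (hf0 : ∀ t, 0 ≤ t → 0 ≤ f t)
    (hf : ∀ s t, 0 ≤ s → s ≤ t → f s ≤ f t) (hρ : ∀ x, radius f lam x ≠ ⊤) {D : ℝ}
    (hD : ∀ x y : X, dist x y ≤ D) (hD0 : 0 ≤ D)
    {ω : X × ℕ → ℝ} (hω : ∀ n p, 0 < (shift^[n] ω) p) (k : ℕ) :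
    radiusCost f lam (2 * k) (requests ω (2 * k)) ≤
      ∑ i ∈ Finset.range (2 * k), (waitCost lam f (firstLoc (shift^[i] ω)) (shift^[i + 1] ω) +
        radius f lam (firstLoc (shift^[i] ω))) + ENNReal.ofReal (Fintype.card X * D) := by
  rw [radiusCost, worstCost, if_pos (exists_isRadius _ _)]
  refine iSup_le fun A => iSup_le fun hA => ?_
  obtain ⟨L, hL⟩ := hA.exists_left
  have hconn := hL.connection_le hρ hD hD0
  have hdel : ∀ i, f (A.serve i - (requests ω (2 * k) i).time) ≤
      f (minWait (ballFinset (firstLoc (shift^[i] ω)) (radius f lam (firstLoc (shift^[i] ω))))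
        (ballFinset_nonempty _ _) (shift^[i + 1] ω)) := fun i => by
    refine hf _ _ (sub_nonneg.2 (A.time_le_serve i)) (Finset.le_inf' _ _ fun y hy => ?_)
    have := hL.serve_le hω i y (mem_ballFinset.1 hy)
    linarith
  have h0 : ∀ i, 0 ≤ f (A.serve i - (requests ω (2 * k) i).time) := fun i =>
    hf0 _ (sub_nonneg.2 (A.time_le_serve i))
  refine (ENNReal.ofReal_le_ofReal (add_le_add_right hconn _)).trans ?_
  rw [← add_assoc, ENNReal.ofReal_add
      (add_nonneg (Finset.sum_nonneg fun i _ => h0 i)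
        (Finset.sum_nonneg fun i _ => ENNReal.toReal_nonneg)) (by positivity),
    ← Finset.sum_add_distrib,
    ENNReal.ofReal_sum_of_nonneg fun i _ => add_nonneg (h0 i) ENNReal.toReal_nonneg,
    Finset.sum_range]
  refine add_le_add_left (Finset.sum_le_sum fun i _ => ?_) _
  rw [ENNReal.ofReal_add (h0 i) ENNReal.toReal_nonneg, ENNReal.ofReal_toReal (hρ _), requests_loc]
  exact add_le_add_left (ENNReal.ofReal_le_ofReal (hdel i)) _

lemma expected_radiusCost_le (lam : X → ℝ) [Fact (∀ x, 0 < lam x)] {α : ℝ} (hα : 0 ≤ α) {D : ℝ}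
    (hD : ∀ x y : X, dist x y ≤ D) (hD0 : 0 ≤ D) (k : ℕ) :
    expected lam (2 * k) (radiusCost (fun t : ℝ => t ^ α) lam (2 * k)) ≤
      (2 * k : ℕ) * (2 * meanRadius lam fun t : ℝ => t ^ α) +
        ENNReal.ofReal (Fintype.card X * D) := by
  set f : ℝ → ℝ := fun t => t ^ α with hf
  have hfm : Measurable f := by fun_prop
  have hm : ∀ x, Measurable fun ω => waitCost lam f x ω + radius f lam x := fun x =>
    (measurable_waitCost lam hfm x).add_const _
  have h1 : expected lam (2 * k) (radiusCost f lam (2 * k)) ≤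
      ∫⁻ ω, (∑ i ∈ Finset.range (2 * k),
        (waitCost lam f (firstLoc (shift^[i] ω)) (shift^[i + 1] ω) +
        radius f lam (firstLoc (shift^[i] ω))) + ENNReal.ofReal (Fintype.card X * D))
          ∂(waitingLaw lam) := by
    refine lintegral_mono_ae ?_
    filter_upwards [ae_shift_pos lam] with ω hω
    exact radiusCost_le lam (fun t ht => Real.rpow_nonneg ht α)
      (fun s t hs hst => Real.rpow_le_rpow hs hst hα) (radius_ne_top lam hα) hD hD0 hω k
  refine h1.trans ?_
  rw [lintegral_add_right _ measurable_const]
  refine add_le_add ?_ (by simp)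
  refine lintegral_sum_le lam (f := f) hm (fun x => ?_) _
  rw [lintegral_add_right _ measurable_const, two_mul]
  exact add_le_add (lintegral_waitCost_le lam hfm x) (by simp)

end RadiusUpper

-- Existence of an output of Greedy

section GreedyExists

variable {X : Type*} [MetricSpace X] {m : ℕ}

/-- The earliest moment at which Greedy may match `i` and `j`. -/
def criticalTime (f : ℝ → ℝ) (σ : Fin m → Request X) (i j : Fin m) : ℝ :=
  sInf {t | max (σ i).time (σ j).time ≤ t ∧
    dist (σ i).loc (σ j).loc ≤ f (t - (σ i).time) + f (t - (σ j).time)}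

lemma criticalTime_comm (f : ℝ → ℝ) (σ : Fin m → Request X) (i j : Fin m) :
    criticalTime f σ i j = criticalTime f σ j i := by
  unfold criticalTime
  congr 1
  ext t
  simp only [Set.mem_ofPred_eq]
  rw [max_comm, dist_comm, add_comm]

lemma criticalTime_mem {f : ℝ → ℝ} (hf : Continuous f) (hf' : Tendsto f atTop atTop)
    (σ : Fin m → Request X) (i j : Fin m) :
    max (σ i).time (σ j).time ≤ criticalTime f σ i j ∧
      dist (σ i).loc (σ j).loc ≤
        f (criticalTime f σ i j - (σ i).time) + f (criticalTime f σ i j - (σ j).time) := by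
  have hclosed : IsClosed {t | max (σ i).time (σ j).time ≤ t ∧
      dist (σ i).loc (σ j).loc ≤ f (t - (σ i).time) + f (t - (σ j).time)} :=
    (isClosed_le continuous_const continuous_id).inter
      (isClosed_le continuous_const
        ((hf.comp (continuous_id.sub continuous_const)).add
          (hf.comp (continuous_id.sub continuous_const))))
  refine hclosed.csInf_mem ?_ ⟨max (σ i).time (σ j).time, fun t ht => ht.1⟩
  have hlim : ∀ c, Tendsto (fun t => f (t - c)) atTop atTop := fun c =>
    hf'.comp (tendsto_atTop_add_const_right _ (-c) tendsto_id)
  have h := (hlim (σ i).time).atTop_add_atTop (hlim (σ j).time)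
  obtain ⟨t, h1, h2⟩ := ((eventually_ge_atTop (max (σ i).time (σ j).time)).and
    (h.eventually_ge_atTop (dist (σ i).loc (σ j).loc))).exists
  exact ⟨t, h1, h2⟩

/-- Match repeatedly a pair with the smallest critical time. If i and j could be matched while both
were pending, their critical time would be below both service times, against the minimality of the
matching. -/
lemma exists_isGreedy {f : ℝ → ℝ} (hf : Continuous f) (hf' : Tendsto f atTop atTop) {k : ℕ}
    (σ : Fin (2 * k) → Request X) : ∃ A : Solution σ, IsGreedy f A := by
  obtain ⟨p, hp, hmin⟩ := exists_greedy_matching (criticalTime f σ) (criticalTime_comm f σ)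
    Finset.univ (by simp)
  have hpp : ∀ i, p (p i) = i := fun i => (hp i (Finset.mem_univ i)).2.1
  have hc := criticalTime_mem hf hf' σ
  let A : Solution σ :=
    { partner := p
      partner_partner := hpp
      partner_ne := fun i => (hp i (Finset.mem_univ i)).2.2
      serve := fun i => criticalTime f σ i (p i)
      serve_partner := fun i => by rw [hpp, criticalTime_comm]
      time_le_serve := fun i => (le_max_left _ _).trans (hc i (p i)).1 }
  refine ⟨A, fun i => (hc i (p i)).2, fun i j hij t hi hj hti htj => ?_⟩
  by_contra! hcon
  have h1 : criticalTime f σ i j ≤ t :=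
    csInf_le ⟨max (σ i).time (σ j).time, fun t ht => ht.1⟩ ⟨max_le hi hj, hcon⟩
  have h2 := hmin i (Finset.mem_univ i) j (Finset.mem_univ j) hij
  exact absurd (h2.trans h1) (not_le.2 (lt_min hti htj))

end GreedyExists

-- The Markov property at a fixed time

lemma measurableSet_crossing {X : Type*} [Fintype X] (τ : ℝ) : MeasurableSet
    {q : ℝ × (X × ℕ → ℝ) | q.1 ≤ τ ∧ ∀ y ∈ Finset.univ, τ - q.1 < q.2 (y, 0)} := by
  have h : MeasurableSet {q : ℝ × (X × ℕ → ℝ) | ∀ y ∈ Finset.univ, τ - q.1 < q.2 (y, 0)} := by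
    simp only [Set.ofPred_forall]
    exact Finset.measurableSet_biInter _ fun y _ => measurableSet_lt (by fun_prop) (by fun_prop)
  exact (measurableSet_le measurable_fst measurable_const).inter h

lemma measurable_crossing_aux {X : Type*} [Fintype X] (τ : ℝ) {V : (X × ℕ → ℝ) → ℝ≥0∞} (hV : Measurable V) : Measurable
    ({q : ℝ × (X × ℕ → ℝ) | q.1 ≤ τ ∧ ∀ y ∈ Finset.univ, τ - q.1 < q.2 (y, 0)}.indicator
      fun q => V (advance Finset.univ (τ - q.1) q.2)) :=
  (hV.comp ((measurable_advance Finset.univ).comp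
    ((measurable_const.sub measurable_fst).prodMk measurable_snd))).indicator
      (measurableSet_crossing τ)

section Crossing

variable {X : Type*} [Fintype X] [Nonempty X]

/-- The value of `V` on the waiting times seen at time `τ` if `τ` lies between the `n`-th arrival
and the next one, and `0` otherwise. -/
def crossing (τ : ℝ) (V : (X × ℕ → ℝ) → ℝ≥0∞) (n : ℕ) (ω : X × ℕ → ℝ) : ℝ≥0∞ :=
  {q : ℝ × (X × ℕ → ℝ) | q.1 ≤ τ ∧ ∀ y ∈ Finset.univ, τ - q.1 < q.2 (y, 0)}.indicator
    (fun q => V (advance Finset.univ (τ - q.1) q.2)) (epoch n ω, shift^[n] ω)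

lemma epoch_eq_state (n : ℕ) (ω : X × ℕ → ℝ) :
    epoch n ω = state 0 (fun _ q => q.1 + q.2) n ω := by
  induction n with
  | zero => simp [state, epoch_zero]
  | succ n ih => rw [epoch_succ, state, ih]

lemma measurable_crossing (τ : ℝ) {V : (X × ℕ → ℝ) → ℝ≥0∞} (hV : Measurable V) (n : ℕ) :
    Measurable (crossing τ V n) :=
  (measurable_crossing_aux τ hV).comp ((measurable_epoch n).prodMk (measurable_shift_iterate n))

variable (lam : X → ℝ) [hlam : Fact (∀ x, 0 < lam x)]

/-- Given the n-th epoch, the future is fresh; conditioned further on no arrival up to τ, the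
residual waits are fresh by memorylessness. -/
lemma lintegral_crossing (τ : ℝ) {V : (X × ℕ → ℝ) → ℝ≥0∞} (hV : Measurable V) (n : ℕ) :
    ∫⁻ ω, crossing τ V n ω ∂(waitingLaw lam) =
      (∫⁻ ω, crossing τ 1 n ω ∂(waitingLaw lam)) * ∫⁻ ω, V ω ∂(waitingLaw lam) := by
  have key : ∀ {V : (X × ℕ → ℝ) → ℝ≥0∞}, Measurable V →
      ∫⁻ ω, crossing τ V n ω ∂(waitingLaw lam) =
      (∫⁻ ω, (if epoch n ω ≤ τ then
        ENNReal.ofReal (Real.exp (-((∑ y, lam y) * (τ - epoch n ω)))) else 0) ∂(waitingLaw lam)) *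
        ∫⁻ ω, V ω ∂(waitingLaw lam) := by
    intro V hV
    have e := lintegral_state lam (0 : ℝ) (g := fun _ q => q.1 + q.2)
      (fun _ => measurable_fst.add measurable_snd) n (measurable_crossing_aux τ hV)
    simp only [← epoch_eq_state] at e
    simp only [crossing]
    have hme := measurable_epoch (X := X) n
    rw [e, ← lintegral_mul_const]
    swap
    · exact Measurable.ite (measurableSet_le hme measurable_const) (by fun_prop) measurable_const
    refine lintegral_congr fun ω => ?_
    split_ifs with h
    · rw [← lintegral_advance lam Finset.univ (sub_nonneg.2 h) hV,
        ← lintegral_indicator (measurableSet_forall_lt _ _)]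
      refine lintegral_congr fun ω' => ?_
      simp only [Set.indicator, Set.mem_ofPred_eq, h, true_and]
    · simp [Set.indicator, h]
  rw [key hV, key (V := 1) measurable_one]
  simp

/-- Almost surely at most one n has τ between its epoch and the next, so the crossing probabilities
sum to at most 1. -/
lemma lintegral_tsum_crossing_le (τ : ℝ) {V : (X × ℕ → ℝ) → ℝ≥0∞} (hV : Measurable V) :
    ∫⁻ ω, ∑' n, crossing τ V n ω ∂(waitingLaw lam) ≤ ∫⁻ ω, V ω ∂(waitingLaw lam) := by
  rw [lintegral_tsum fun n => (measurable_crossing τ hV n).aemeasurable]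
  simp only [lintegral_crossing lam τ hV]
  rw [ENNReal.tsum_mul_right,
    ← lintegral_tsum fun n => (measurable_crossing τ measurable_one n).aemeasurable]
  refine mul_le_of_le_one_left' ?_
  have h : ∀ᵐ ω ∂(waitingLaw lam), ∑' n, crossing τ 1 n ω ≤ 1 := by
    filter_upwards [ae_shift_pos lam] with ω hω
    have hlt : ∀ n, crossing τ 1 n ω ≠ 0 → epoch n ω ≤ τ ∧ τ < epoch (n + 1) ω := by
      intro n hn
      have h1 := Set.mem_of_indicator_ne_zero hn
      refine ⟨h1.1, ?_⟩
      have h2 := h1.2 (firstLoc (shift^[n] ω)) (Finset.mem_univ _)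
      rw [epoch_succ, firstGap]
      simp only at h2
      linarith
    by_cases hex : ∃ n, crossing τ 1 n ω ≠ 0
    · obtain ⟨n, hn⟩ := hex
      rw [tsum_eq_single n]
      · exact Set.indicator_le_self' (fun _ _ => zero_le) _
      · intro l hl
        by_contra hl0
        have h1 := hlt n hn
        have h2 := hlt l hl0
        have hm := epoch_strictMono hω
        rcases hl.lt_or_gt with h | h
        · have := hm.monotone (Nat.succ_le_of_lt h)
          simp only [Nat.succ_eq_add_one] at this
          linarith
        · have := hm.monotone (Nat.succ_le_of_lt h)
          simp only [Nat.succ_eq_add_one] at this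
          linarith
    · push Not at hex
      simp [hex]
  exact (lintegral_mono_ae h).trans (by simp)

end Crossing

lemma minWait_advance {X : Type*} [Fintype X] (B : Finset X) (hB : B.Nonempty) (t : ℝ)
    (ω : X × ℕ → ℝ) : minWait B hB (advance Finset.univ t ω) = minWait B hB ω - t := by
  have hadv : ∀ y, advance Finset.univ t ω (y, 0) = ω (y, 0) - t := fun y => by simp [advance]
  refine le_antisymm ?_ (Finset.le_inf' _ _ fun y hy => ?_)
  · rw [le_sub_iff_add_le]
    refine Finset.le_inf' _ _ fun y hy => ?_
    rw [← le_sub_iff_add_le, ← hadv]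
    exact Finset.inf'_le (fun y => advance Finset.univ t ω (y, 0)) hy
  · rw [hadv]
    exact sub_le_sub_right (Finset.inf'_le (fun y => ω (y, 0)) hy) t

-- Upper bound for Greedy

section GreedyUpper

variable {X : Type*} [MetricSpace X] {m : ℕ} {σ : Fin m → Request X} {f : ℝ → ℝ}

/-- If i outlasts the arrival of k, then k was matched at once with another j, at a distance at most
the delay cost of j. As i has waited for more than τ, its delay cost exceeds d(i, k), so the
triangle inequality makes i and j matchable already just before k arrived. -/
lemma IsGreedy.serve_le {A : Solution σ} (hA : IsGreedy f A) (hf : Continuous f) (hf0 : f 0 = 0)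
    (hmono : ∀ s t, 0 ≤ s → s < t → f s < f t) (hσ : ∀ i j, (σ i).time = (σ j).time → i = j)
    {i k : Fin m} {τ : ℝ} (hτ : 0 ≤ τ) (hik : (σ i).time + τ < (σ k).time)
    (hd : dist (σ i).loc (σ k).loc ≤ f τ) : A.serve i ≤ (σ k).time := by
  by_contra! hlt
  have hne : i ≠ k := fun h => by
    rw [h] at hik
    linarith
  have hfτ : f τ < f ((σ k).time - (σ i).time) := hmono _ _ hτ (by linarith)
  have hk : A.serve k = (σ k).time := by
    refine le_antisymm ?_ (A.time_le_serve k)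
    by_contra! h
    have := hA.pending i k hne (σ k).time (by linarith) le_rfl hlt h
    rw [sub_self, hf0] at this
    linarith
  set j := A.partner k with hj
  have hjk : j ≠ k := A.partner_ne k
  have hsj : A.serve j = (σ k).time := by rw [hj, A.serve_partner, hk]
  have hij : i ≠ j := fun h => by
    rw [h, hsj] at hlt
    exact lt_irrefl _ hlt
  have htj : (σ j).time < (σ k).time :=
    lt_of_le_of_ne (hsj ▸ A.time_le_serve j) fun h => hjk (hσ _ _ h)
  have hmatch := hA.matched k
  rw [hk, sub_self, hf0, ← hj] at hmatch
  -- At the arrival of k, j is no longer pending, so the pending rule is used at earlier times and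
  -- passed to the limit; the inequality becomes weak, and strictness comes from `hfτ`.
  have hlim : f ((σ k).time - (σ i).time) + f ((σ k).time - (σ j).time) ≤
      dist (σ i).loc (σ j).loc := by
    have hcont : Continuous fun t => f (t - (σ i).time) + f (t - (σ j).time) := by fun_prop
    refine le_of_tendsto (hcont.continuousWithinAt (s := Set.Iio (σ k).time)) ?_
    have hmax : max (σ i).time (σ j).time < (σ k).time := max_lt (by linarith) htj
    filter_upwards [Ioo_mem_nhdsLT hmax] with t ht
    exact (hA.pending i j hij t ((le_max_left _ _).trans ht.1.le)
      ((le_max_right _ _).trans ht.1.le) (ht.2.trans hlt) (hsj ▸ ht.2)).le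
  have htri := dist_triangle (σ i).loc (σ k).loc (σ j).loc
  linarith

lemma IsGreedy.cost_le {A : Solution σ} (hA : IsGreedy f A) :
    A.cost f ≤ 2 * ∑ i, f (A.serve i - (σ i).time) := by
  rw [Solution.cost, two_mul]
  refine add_le_add le_rfl ?_
  rw [A.sum_eq]
  refine Finset.sum_le_sum fun i _ => ?_
  rw [A.serve_partner]
  exact hA.matched i

/-- After the last arrival a request waits together with its own partner, and at time T + δ its
delay cost alone exceeds their distance. -/
lemma IsGreedy.serve_le_add {A : Solution σ} (hA : IsGreedy f A)
    (hmono : ∀ s t, 0 ≤ s → s ≤ t → f s ≤ f t) (hf0 : ∀ t, 0 ≤ t → 0 ≤ f t) {D δ T : ℝ}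
    (hD : ∀ x y : X, dist x y ≤ D) (hδ0 : 0 ≤ δ) (hδ : D ≤ f δ) (hT : ∀ i, (σ i).time ≤ T)
    (i : Fin m) : A.serve i ≤ T + δ := by
  by_contra! h
  have h1 := hT i
  have h2 := hT (A.partner i)
  have := hA.pending i (A.partner i) (A.partner_ne i).symm (T + δ) (by linarith) (by linarith) h
    (by rwa [A.serve_partner])
  have h3 := hmono δ (T + δ - (σ i).time) hδ0 (by linarith)
  have h4 := hf0 (T + δ - (σ (A.partner i)).time) (by linarith)
  have h5 := hD (σ i).loc (σ (A.partner i)).loc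
  linarith

/-- Two pending requests at one location have distance 0 and would be matched at once. -/
lemma IsGreedy.card_late_le [Fintype X] {A : Solution σ} (hA : IsGreedy f A)
    (hf0 : ∀ t, 0 ≤ t → 0 ≤ f t) {T : ℝ} (hT : ∀ i, (σ i).time ≤ T) :
    (Finset.univ.filter fun i => T < A.serve i).card ≤ Fintype.card X := by
  refine Finset.card_le_card_of_injOn (fun i => (σ i).loc) (by simp) ?_
  intro i hi j hj hij
  simp only [Finset.coe_filter, Finset.mem_univ, true_and, Set.mem_ofPred_eq] at hi hj hij
  by_contra hne
  have := hA.pending i j hne T (hT i) (hT j) hi hj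
  rw [hij, dist_self] at this
  have h1 := hf0 _ (sub_nonneg.2 (hT i))
  have h2 := hf0 _ (sub_nonneg.2 (hT j))
  linarith

variable [Fintype X] [Nonempty X] (lam : X → ℝ)

/-- Bound for the delay cost of a request at `x` before the last arrival, in terms of the process
after the arrival of this request. -/
def greedyWait (α : ℝ) (x : X) (ω : X × ℕ → ℝ) : ℝ≥0∞ :=
  ENNReal.ofReal (2 ^ α) * (radius (fun t => t ^ α) lam x +
    ∑' n, crossing ((radius (fun t => t ^ α) lam x).toReal ^ α⁻¹)
      (waitCost lam (fun t => t ^ α) x) n ω)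

/-- Up to the last arrival the delay is at most τ plus the wait for the ball from the fixed time τ
after the request, and (a + b)^α ≤ 2^α (a^α + b^α) separates the two. -/
lemma ofReal_delay_le [Fact (∀ x, 0 < lam x)] {α : ℝ} (hα : 0 < α) {ω : X × ℕ → ℝ}
    (hω : ∀ n p, 0 < (shift^[n] ω) p)
    {A : Solution (requests ω m)} (hA : IsGreedy (fun t => t ^ α) A) (i : Fin m) :
    ENNReal.ofReal ((min (A.serve i) (epoch m ω) - (requests ω m i).time) ^ α) ≤
      greedyWait lam α (firstLoc (shift^[i] ω)) (shift^[i + 1] ω) := by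
  set x := firstLoc (shift^[i] ω) with hx
  set ρ := radius (fun t : ℝ => t ^ α) lam x with hρ
  have hρt : ρ ≠ ⊤ := radius_ne_top lam hα.le x
  set τ := ρ.toReal ^ α⁻¹ with hτ
  have hτ0 : 0 ≤ τ := by positivity
  have hfτ : τ ^ α = ρ.toReal := Real.rpow_inv_rpow ENNReal.toReal_nonneg hα.ne'
  have hmono := epoch_strictMono hω
  have htm : ∀ j, (requests ω m j).time ≤ epoch m ω := fun j => by
    rw [requests_time]
    exact hmono.monotone j.2
  set s := min (A.serve i) (epoch m ω) with hs
  have hs0 : 0 ≤ s - (requests ω m i).time :=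
    sub_nonneg.2 (le_min (A.time_le_serve i) (htm i))
  have h2 : ENNReal.ofReal (2 ^ α) ≥ 1 := by
    rw [ge_iff_le, ENNReal.one_le_ofReal]
    exact Real.one_le_rpow (by norm_num) hα.le
  rw [greedyWait, ← hρ, ← hτ]
  by_cases hcase : s ≤ (requests ω m i).time + τ
  · have h3 : (s - (requests ω m i).time) ^ α ≤ ρ.toReal := by
      rw [← hfτ]
      exact Real.rpow_le_rpow hs0 (by linarith) hα.le
    calc _ ≤ ρ := (ENNReal.ofReal_le_ofReal h3).trans (by rw [ENNReal.ofReal_toReal hρt])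
      _ ≤ 1 * (ρ + _) := by
        rw [one_mul]
        exact le_self_add
      _ ≤ _ := mul_le_mul_left h2 _
  push Not at hcase
  have htm' : (requests ω m i).time + τ < epoch m ω := hcase.trans_le (min_le_right _ _)
  have hexN : ∃ N, (requests ω m i).time + τ < epoch (i + 1 + N) ω :=
    ⟨m - (i + 1), by rwa [Nat.add_sub_cancel' i.2]⟩
  -- The only crossing term that is needed: n arrivals after request i occur by time τ after it.
  obtain ⟨n, hn1, hn2⟩ : ∃ n, epoch (i + 1 + n) ω ≤ (requests ω m i).time + τ ∧
      (requests ω m i).time + τ < epoch (i + 1 + n + 1) ω := by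
    classical
    have hfind := Nat.find_spec hexN
    have hpos : Nat.find hexN ≠ 0 := fun h => by
      rw [h, requests_time] at hfind
      simp only [add_zero] at hfind
      linarith
    obtain ⟨n, hn⟩ := Nat.exists_eq_succ_of_ne_zero hpos
    refine ⟨n, not_lt.1 (Nat.find_min hexN (by omega)), ?_⟩
    rw [hn] at hfind
    exact hfind
  have hnm : i + 1 + n ≤ m := by
    by_contra! h
    have : epoch m ω ≤ epoch (i + 1 + n) ω := hmono.monotone h.le
    linarith
  have hshift : ∀ n, shift^[n] (shift^[i + 1] ω) = shift^[i + 1 + n] ω := fun n => by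
    rw [← Function.iterate_add_apply, add_comm]
  have hep : epoch n (shift^[i + 1] ω) = epoch (i + 1 + n) ω - (requests ω m i).time := by
    rw [epoch_add (i + 1) n, requests_time]
    ring
  have hcross : crossing τ (waitCost lam (fun t => t ^ α) x) n (shift^[i + 1] ω) =
      waitCost lam (fun t => t ^ α) x (advance Finset.univ (τ - epoch n (shift^[i + 1] ω))
        (shift^[i + 1 + n] ω)) := by
    rw [crossing, hshift, Set.indicator_of_mem]
    refine ⟨by simp only [hep]; linarith, fun y _ => ?_⟩
    have h3 := firstGap_le (shift^[i + 1 + n] ω) y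
    rw [epoch_succ] at hn2
    simp only [hep]
    linarith
  have hserve : ∀ y ∈ ballFinset x ρ, s ≤ epoch (i + 1 + n) ω + (shift^[i + 1 + n] ω) (y, 0) := by
    intro y hy
    rcases exists_next_arrival hω y hnm with ⟨k, hk1, hk2, hk3, hk4⟩ | hlast
    · refine (min_le_left _ _).trans ?_
      have hlt : (requests ω m i).time + τ < (requests ω m ⟨k, hk2⟩).time := by
        rw [requests_time ω m ⟨k, hk2⟩]
        exact hn2.trans_le (hmono.monotone (Nat.succ_le_succ hk1))
      rw [← hk4, ← requests_time ω m ⟨k, hk2⟩]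
      refine hA.serve_le (Real.continuous_rpow_const hα.le) (Real.zero_rpow hα.ne')
        (fun s t hs hst => Real.rpow_lt_rpow hs hst hα) ?_ hτ0 hlt ?_
      · intro a b hab
        rw [requests_time, requests_time] at hab
        have := hmono.injective hab
        exact Fin.ext (by omega)
      · rw [requests_loc, requests_loc, hfτ, dist_edist]
        refine ENNReal.toReal_mono hρt ?_
        have := mem_ballFinset.1 hy
        rwa [← hk3] at this
    · exact (min_le_right _ _).trans hlast.le
  have hwait : (s - (requests ω m i).time - τ) ^ α ≤
      (minWait (ballFinset x ρ) (ballFinset_nonempty x _) (shift^[i + 1 + n] ω) -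
        (τ - epoch n (shift^[i + 1] ω))) ^ α := by
    refine Real.rpow_le_rpow (by linarith) ?_ hα.le
    rw [hep]
    have : s - epoch (i + 1 + n) ω ≤
        minWait (ballFinset x ρ) (ballFinset_nonempty x _) (shift^[i + 1 + n] ω) :=
      Finset.le_inf' _ _ fun y hy => by linarith [hserve y hy]
    linarith
  have hsum : (s - (requests ω m i).time) ^ α ≤
      2 ^ α * (ρ.toReal + (minWait (ballFinset x ρ) (ballFinset_nonempty x _) (shift^[i + 1 + n] ω) -
        (τ - epoch n (shift^[i + 1] ω))) ^ α) := by
    have h3 := add_rpow_le_two_rpow_mul hα.le hτ0 (b := s - (requests ω m i).time - τ)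
      (by linarith)
    rw [hfτ, add_sub_cancel] at h3
    refine h3.trans ?_
    gcongr
  refine (ENNReal.ofReal_le_ofReal hsum).trans ?_
  rw [ENNReal.ofReal_mul (by positivity)]
  refine mul_le_mul_right (ENNReal.ofReal_add_le.trans ?_) _
  rw [ENNReal.ofReal_toReal hρt]
  refine add_le_add_right ?_ _
  refine le_trans (le_of_eq ?_) (ENNReal.le_tsum n)
  rw [hcross, waitCost, minWait_advance]

lemma measurable_crossing_waitCost (α τ : ℝ) (x : X) : Measurable fun ω =>
    ∑' n, crossing τ (waitCost lam (fun t => t ^ α) x) n ω :=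
  Measurable.tsum fun n =>
    measurable_crossing τ (measurable_waitCost lam (show Measurable fun t : ℝ => t ^ α by fun_prop) x) n

lemma measurable_greedyWait (α : ℝ) (x : X) : Measurable (greedyWait lam α x) :=
  (measurable_const.add (measurable_crossing_waitCost lam α _ x)).const_mul _

lemma lintegral_greedyWait_le [Fact (∀ x, 0 < lam x)] (α : ℝ) (x : X) :
    ∫⁻ ω, greedyWait lam α x ω ∂(waitingLaw lam) ≤
      (ENNReal.ofReal (2 ^ α) * 2) * radius (fun t => t ^ α) lam x := by
  have hf : Measurable fun t : ℝ => t ^ α := by fun_prop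
  simp only [greedyWait]
  rw [lintegral_const_mul' _ _ ENNReal.ofReal_ne_top, lintegral_add_left measurable_const,
    mul_assoc, two_mul]
  gcongr
  · simp
  · exact (lintegral_tsum_crossing_le lam _ (measurable_waitCost lam hf x)).trans
      (lintegral_waitCost_le lam hf x)

lemma greedyCost_le [Fact (∀ x, 0 < lam x)] {α : ℝ} (hα : 0 < α) {D δ : ℝ}
    (hD : ∀ x y : X, dist x y ≤ D) (hδ0 : 0 ≤ δ) (hδ : D ≤ δ ^ α)
    {ω : X × ℕ → ℝ} (hω : ∀ n p, 0 < (shift^[n] ω) p) (k : ℕ) :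
    greedyCost (fun t => t ^ α) (2 * k) (requests ω (2 * k)) ≤
      ENNReal.ofReal (2 * 2 ^ α) * (∑ i ∈ Finset.range (2 * k),
        greedyWait lam α (firstLoc (shift^[i] ω)) (shift^[i + 1] ω) +
          ENNReal.ofReal (Fintype.card X * δ ^ α)) := by
  classical
  have hcont : Continuous fun t : ℝ => t ^ α := Real.continuous_rpow_const hα.le
  rw [greedyCost, worstCost, if_pos (exists_isGreedy hcont (tendsto_rpow_atTop hα) _)]
  refine iSup_le fun A => iSup_le fun hA => ?_
  have hmono := (epoch_strictMono hω).monotone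
  have hT : ∀ j, (requests ω (2 * k) j).time ≤ epoch (2 * k) ω := fun j => by
    rw [requests_time]
    exact hmono j.2
  set T := epoch (2 * k) ω with hTdef
  have hf0 : ∀ t : ℝ, 0 ≤ t → 0 ≤ t ^ α := fun t ht => Real.rpow_nonneg ht α
  have hfm : ∀ s t : ℝ, 0 ≤ s → s ≤ t → s ^ α ≤ t ^ α := fun s t hs hst =>
    Real.rpow_le_rpow hs hst hα.le
  let w : Fin (2 * k) → ℝ := fun i => (min (A.serve i) T - (requests ω (2 * k) i).time) ^ α
  have hw0 : ∀ i, 0 ≤ w i := fun i =>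
    hf0 _ (sub_nonneg.2 (le_min (A.time_le_serve i) (hT i)))
  have h1 : ∀ i, (A.serve i - (requests ω (2 * k) i).time) ^ α ≤
      2 ^ α * (w i + if T < A.serve i then δ ^ α else 0) := by
    intro i
    split_ifs with h
    · have h3 := hA.serve_le_add hfm hf0 hD hδ0 hδ hT i
      have h4 := hT i
      refine le_trans ?_ (add_rpow_le_two_rpow_mul hα.le
        (sub_nonneg.2 (le_min (A.time_le_serve i) (hT i))) hδ0)
      refine hfm _ _ (by linarith) ?_
      rw [min_eq_right h.le]
      linarith
    · simp only [w, add_zero]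
      rw [min_eq_left (not_lt.1 h)]
      exact le_mul_of_one_le_left (hf0 _ (sub_nonneg.2 (A.time_le_serve i)))
        (Real.one_le_rpow (by norm_num) hα.le)
  have h2 : A.cost (fun t => t ^ α) ≤ (2 * 2 ^ α) * (∑ i, w i + Fintype.card X * δ ^ α) := by
    refine hA.cost_le.trans ?_
    rw [mul_assoc]
    refine mul_le_mul_of_nonneg_left ?_ (by norm_num)
    refine (Finset.sum_le_sum fun i _ => h1 i).trans ?_
    rw [← Finset.mul_sum, Finset.sum_add_distrib, ← Finset.sum_filter, Finset.sum_const,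
      nsmul_eq_mul]
    have := hA.card_late_le hf0 hT
    have := hf0 δ hδ0
    gcongr
  refine (ENNReal.ofReal_le_ofReal h2).trans ?_
  rw [ENNReal.ofReal_mul (by positivity)]
  refine mul_le_mul_right (ENNReal.ofReal_add_le.trans (add_le_add_left ?_ _)) _
  rw [ENNReal.ofReal_sum_of_nonneg fun i _ => hw0 i, Finset.sum_range]
  exact Finset.sum_le_sum fun i _ => ofReal_delay_le lam hα hω hA i

lemma expected_greedyCost_le [Fact (∀ x, 0 < lam x)] {α : ℝ} (hα : 0 < α) {D δ : ℝ}
    (hD : ∀ x y : X, dist x y ≤ D) (hδ0 : 0 ≤ δ) (hδ : D ≤ δ ^ α) (k : ℕ) :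
    expected lam (2 * k) (greedyCost (fun t : ℝ => t ^ α) (2 * k)) ≤
      (2 * k : ℕ) * ((ENNReal.ofReal (2 * 2 ^ α) * (ENNReal.ofReal (2 ^ α) * 2)) *
        meanRadius lam fun t : ℝ => t ^ α) +
        ENNReal.ofReal (2 * 2 ^ α) * ENNReal.ofReal (Fintype.card X * δ ^ α) := by
  refine (lintegral_mono_ae (g := fun ω => ENNReal.ofReal (2 * 2 ^ α) *
    (∑ i ∈ Finset.range (2 * k),
      greedyWait lam α (firstLoc (shift^[i] ω)) (shift^[i + 1] ω) +
        ENNReal.ofReal (Fintype.card X * δ ^ α))) ?_).trans ?_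
  · filter_upwards [ae_shift_pos lam] with ω hω
    exact greedyCost_le lam hα hD hδ0 hδ hω k
  rw [lintegral_const_mul' _ _ ENNReal.ofReal_ne_top, lintegral_add_right _ measurable_const,
    mul_add]
  refine add_le_add ?_ (by simp)
  refine (mul_le_mul_right (lintegral_sum_le lam (measurable_greedyWait lam α) (lintegral_greedyWait_le lam α) _) _).trans ?_
  exact le_of_eq (by ring)

end GreedyUpper

-- Comparison and constants

lemma exists_dist_le (X : Type*) [Fintype X] [MetricSpace X] :
    ∃ D : ℝ, 0 ≤ D ∧ ∀ x y : X, dist x y ≤ D :=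
  ⟨Metric.diam (Set.univ : Set X), Metric.diam_nonneg, fun _ _ =>
    Metric.dist_le_diam_of_mem Set.finite_univ.isBounded trivial trivial⟩

lemma hasRatioOfExpectations_of_le {X : Type*} [Fintype X] [MetricSpace X] [Nonempty X]
    {lam : X → ℝ} {f : ℝ → ℝ} {alg : (m : ℕ) → (Fin m → Request X) → ℝ≥0∞} {C : ℝ} {R K a c : ℝ≥0∞}
    (hC : 1 ≤ C) (hR : R ≠ 0) (ha : a ≠ 0) (hK : K ≠ ⊤)
    (halg : ∀ k : ℕ, expected lam (2 * k) (alg (2 * k)) ≤ (2 * k : ℕ) * (a * R) + K)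
    (hopt : ∀ m : ℕ, m * (c * R) ≤ expected lam m (opt f)) (hac : 2 * a ≤ ENNReal.ofReal C * c) :
    HasRatioOfExpectations f lam alg C := by
  refine ⟨hC, limsup_le_of_le (by isBoundedDefault) ?_⟩
  -- For large k the boundary cost K is at most the main term, which explains the factor 2 in `hac`.
  obtain ⟨N, hN⟩ := ENNReal.exists_nat_mul_gt (mul_ne_zero ha hR) hK
  filter_upwards [eventually_ge_atTop N] with k hk
  refine ENNReal.div_le_of_le_mul ?_
  have h1 : K ≤ (2 * k : ℕ) * (a * R) := by
    refine hN.le.trans (mul_le_mul_left ?_ _)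
    exact_mod_cast (show N ≤ 2 * k by omega)
  calc expected lam (2 * k) (alg (2 * k)) ≤ (2 * k : ℕ) * (a * R) + (2 * k : ℕ) * (a * R) :=
        (halg k).trans (add_le_add_right h1 _)
    _ = (2 * a) * ((2 * k : ℕ) * R) := by ring
    _ ≤ (ENNReal.ofReal C * c) * ((2 * k : ℕ) * R) := mul_le_mul_left hac _
    _ = ENNReal.ofReal C * ((2 * k : ℕ) * (c * R)) := by ring
    _ ≤ _ := mul_le_mul_right (hopt _) _

lemma two_pow_le_exp (n : ℕ) : (2 : ℝ) ^ n ≤ Real.exp n := by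
  have h : (2 : ℝ) ≤ Real.exp 1 := by linarith [Real.add_one_le_exp 1]
  rw [← Real.exp_one_pow]
  gcongr

lemma two_rpow_le_exp {α : ℝ} (hα : 0 ≤ α) : (2 : ℝ) ^ α ≤ Real.exp α := by
  have h : (2 : ℝ) ≤ Real.exp 1 := by linarith [Real.add_one_le_exp 1]
  calc (2 : ℝ) ^ α ≤ Real.exp 1 ^ α := Real.rpow_le_rpow (by norm_num) h hα
    _ = Real.exp α := by rw [Real.exp_one_rpow]

lemma ofReal_le_ofReal_exp_mul {α b : ℝ} (hb : 4 * b ≤ Real.exp (8 * (1 + α))) :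
    ENNReal.ofReal b ≤ ENNReal.ofReal (Real.exp (10 * (1 + α))) *
      (ENNReal.ofReal (Real.exp (-(2 * (1 + α)))) / 4) := by
  have h4 : (4 : ℝ≥0∞) = ENNReal.ofReal 4 := by norm_num
  rw [h4, ← ENNReal.ofReal_div_of_pos (by norm_num), ← ENNReal.ofReal_mul (Real.exp_nonneg _),
    ← mul_div_assoc, ← Real.exp_add]
  refine ENNReal.ofReal_le_ofReal ?_
  rw [le_div_iff₀ (by norm_num), show 10 * (1 + α) + -(2 * (1 + α)) = 8 * (1 + α) by ring]
  linarith

end MPMD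

end

theorem mainTheorem6 :
    ∃ C : ℝ, 0 < C ∧
      ∀ (X : Type*) [Fintype X] [Nonempty X] [MetricSpace X] (lam : X → ℝ), (∀ x, 0 < lam x) →
        (∀ α : ℝ, 0 < α →
          MPMD.HasRatioOfExpectations (fun t : ℝ => t ^ α) lam
            (MPMD.greedyCost (fun t : ℝ => t ^ α)) (Real.exp (C * (1 + α)))) ∧
        (∀ α : ℝ, 0 ≤ α →
          MPMD.HasRatioOfExpectations (fun t : ℝ => t ^ α) lam
            (MPMD.radiusCost (fun t : ℝ => t ^ α) lam) (Real.exp (C * (1 + α)))) := by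
  -- The exponent 10(1+α) spends 2(1+α) on the isolation probability. The remaining e^{8(1+α)}
  -- covers 32·4^α ≤ e^{5+2α} for Greedy and 16 ≤ e^4 for Radius.
  refine ⟨10, by norm_num, fun X _ _ _ lam hlam => ?_⟩
  have : Fact (∀ x, 0 < lam x) := ⟨hlam⟩
  obtain ⟨D, hD0, hD⟩ := MPMD.exists_dist_le X
  refine ⟨fun α hα => ?_, fun α hα => ?_⟩
  · refine MPMD.hasRatioOfExpectations_of_le (Real.one_le_exp (by positivity))
      (MPMD.meanRadius_pos lam hα.le).ne' ?_ ?_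
      -- Here δ = D^{1/α}, so that a delay of δ costs exactly the diameter bound D.
      (MPMD.expected_greedyCost_le lam hα hD (Real.rpow_nonneg hD0 α⁻¹)
        (Real.rpow_inv_rpow hD0 hα.ne').ge)
      (MPMD.le_expected_opt lam hα.le) ?_
    · have h : (0 : ℝ) < 2 ^ α := by positivity
      simp [h]
    · exact ENNReal.mul_ne_top ENNReal.ofReal_ne_top ENNReal.ofReal_ne_top
    · refine le_trans (le_of_eq ?_) (MPMD.ofReal_le_ofReal_exp_mul
        (b := 2 * ((2 * 2 ^ α) * (2 ^ α * 2))) ?_)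
      · conv_rhs => rw [ENNReal.ofReal_mul (by norm_num),
          ENNReal.ofReal_mul (p := 2 * 2 ^ α) (by positivity),
          ENNReal.ofReal_mul (p := 2 ^ α) (q := 2) (by positivity)]
        norm_num
      · have h1 := MPMD.two_rpow_le_exp hα.le
        have h2 := MPMD.two_pow_le_exp 5
        have h3 : Real.exp (8 * (1 + α)) ≥ Real.exp (5 : ℕ) * (Real.exp α * Real.exp α) := by
          rw [← Real.exp_add, ← Real.exp_add]
          refine Real.exp_le_exp.2 ?_
          push_cast
          linarith
        refine le_trans ?_ h3
        calc 4 * (2 * ((2 * 2 ^ α) * (2 ^ α * 2))) = (2 : ℝ) ^ 5 * (2 ^ α * 2 ^ α) := by ring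
          _ ≤ _ := by gcongr
  · refine MPMD.hasRatioOfExpectations_of_le (Real.one_le_exp (by positivity))
      (MPMD.meanRadius_pos lam hα).ne' two_ne_zero ENNReal.ofReal_ne_top
      (MPMD.expected_radiusCost_le lam hα hD hD0) (MPMD.le_expected_opt lam hα) ?_
    refine le_trans (le_of_eq ?_) (MPMD.ofReal_le_ofReal_exp_mul (b := 4) ?_)
    · norm_num
    · have h2 := MPMD.two_pow_le_exp 4
      have h3 : Real.exp (8 * (1 + α)) ≥ Real.exp (4 : ℕ) :=
        Real.exp_le_exp.2 (by push_cast; linarith)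
      linarith
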